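/- Let $\mathcal A$ be a commutative unital $C^*$-algebra with maximal ideal space $X$ (so $\mathcal A=C(X)$), and let $\delta:\mathcal A\to\mathcal A$ be a $*$-endomorphism, not necessarily unital. Let $\Delta_1=\{x\in X: x(\delta(1))=1\}$ (a clopen set), let $\alpha:\Delta_1\to X$, $\alpha(x)=x\circ\delta$, be the dual partial mapping, let $\Delta_n$ be the domain of $\alpha^n$ ($n\ge 0$), and assume that the image $\Delta_{-1}=\alpha(\Delta_1)$ is open. Adjoin to $X$ an isolated point $0$, and let $\widetilde X\subset\prod_{n\ge0}(X\cup\{0\})$ be the compact space, with the topology induced by the product topology, of all sequences $(x_0,x_1,\dots)$ with $x_n\in\Delta_n$ and $\alpha(x_n)=x_{n-1}$ for $n\ge1$ that are either infinite in $X$, or of the form $(x_0,\dots,x_N,0,0,\dots)$ with $x_N\notin\Delta_{-1}$. Let $\widetilde\alpha(x_0,x_1,\dots)=(\alpha(x_0),x_0,x_1,\dots)$, a homeomorphism of $\widetilde\Delta_1=\{x_0\in\Delta_1\}$ onto $\widetilde\Delta_{-1}=\{x_0\in\Delta_{-1}\}$ (both clopen), and let $\widetilde\delta$ be the partial automorphism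 of $\mathcal B=C(\widetilde X)$ given by $\widetilde\delta(b)=b\circ\widetilde\alpha$ on $\widetilde\Delta_1$ and $0$ elsewhere. For $n\in\mathbb Z$ let $D_n\subset\mathcal B$ be the ideal of functions vanishing outside the domain of $\widetilde\alpha^n$, which is the range of $\widetilde\delta^n$. The covariance algebra $C^*(\mathcal A,\delta)=\mathcal B\rtimes_{\widetilde\delta}\mathbb Z$ is the enveloping $C^*$-algebra of the Banach $*$-algebra $L=\{a\in\ell^1(\mathbb Z,\mathcal B): a(n)\in D_n\}$ with $$(a*b)(n)=\sum_{k\in\mathbb Z}\widetilde\delta^k\big(\widetilde\delta^{-k}(a(k))\,b(n-k)\big),\qquad (a^*)(n)=\widetilde\delta^n(a(-n)^*).$$ Write $b\,u^n$ for the element with value $b\in D_n$ at $n$ and $0$ elsewhere, and $u=1_{D_1}u^1$. For a finitely supported sequence $(a_k)_{k\ge 0}$ with $a_k\in\delta^k(1)\mathcal A$, let $[a_0,a_1,\dots]\in\mathcal B$ be the function $(x_0,x_1,\dots)\mapsto\sum_k a_k(x_k)$, where $a_k(0)=0$; map $\mathcal A$ into $C^*(\mathcal A,\delta)$ by $a\mapsto[a,0,0,\dots]u^0$.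 A covariant representation of $(\mathcal A,\delta)$ is a triple $(\pi,U,H)$, where $\pi:\mathcal A\to L(H)$ is a representation ($*$-homomorphism) on a Hilbert space $H$ and $U\in L(H)$ is a partial isometry with initial space $\pi(C_{\Delta_{-1}}(X))H$ and final space $\pi(C_{\Delta_1}(X))H$ such that $U\pi(a)U^*=\pi(\delta(a))$ for all $a\in\mathcal A$; here $C_K(X)$ denotes the functions vanishing outside $K$. It is faithful if $\pi$ is injective. Write $U^{-n}=U^{*n}$ for $n\ge 0$. **Theorem.** (1) Let $(\pi,U,H)$ be a covariant representation such that it is faithful or $\delta$ is a monomorphism. Then there is a unique representation $\overline\pi\times U$ of $C^*(\mathcal A,\delta)$ on $H$ with $$(\overline\pi\times U)\Big(\sum_{n=-N}^N a(n)u^n\Big)=\sum_{n=-N}^N\Big(\sum_{k\ge0}U^{*k}\pi(a^{(n)}_k)U^k\Big)U^n$$ for all $N$ and all $a(n)=[a_0^{(n)},a_1^{(n)},\dots]\in D_n$ as above, and its range is the $C^*$-algebra $C^*(\pi(\mathcal A),U)$ generated by $\pi(\mathcal A)$ and $U$. (2) If $\sigma$ is a representation of $C^*(\mathcal A,\delta)$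 on a Hilbert space $H$, $\pi$ is its restriction to $\mathcal A$ and $U=\sigma(u)$, then $(\pi,U,H)$ is a covariant representation of $(\mathcal A,\delta)$. (3) If $\delta$ is a monomorphism, then for every Hilbert space $H$ the map $(\pi,U,H)\mapsto\overline\pi\times U$ is a bijection from the covariant representations of $(\mathcal A,\delta)$ on $H$ onto the representations of $C^*(\mathcal A,\delta)$ on $H$; its inverse is $\sigma\mapsto(\sigma|_{\mathcal A},\sigma(u),H)$. -/

import Mathlib

noncomputable section

/-! ### The enveloping C*-algebra of a normed `*`-algebra -/

/-- A C*-seminorm on a normed `*`-algebra. Every `*`-representation `φ` by bounded operators gives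
the C*-seminorm `x ↦ ‖φ x‖`, and every C*-seminorm arises in this way (complete the quotient).
On a Banach `*`-algebra with isometric involution the bound `le_norm'` is automatic. -/
structure CStarSeminorm (L : Type*) [NormedRing L] [NormedAlgebra ℂ L] [StarRing L]
    extends Seminorm ℂ L where
  mul_le' : ∀ x y : L, toFun (x * y) ≤ toFun x * toFun y
  star_mul_self' : ∀ x : L, toFun (star x * x) = toFun x ^ 2
  le_norm' : ∀ x : L, toFun x ≤ ‖x‖

namespace CStarSeminorm

variable {L : Type*} [NormedRing L] [NormedAlgebra ℂ L] [StarRing L]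

instance : Nonempty (CStarSeminorm L) :=
  ⟨{ toSeminorm := 0
     mul_le' := fun x y => by
      change (0 : ℝ) ≤ 0 * 0
      simp
     star_mul_self' := fun x => by
      change (0 : ℝ) = 0 ^ 2
      simp
     le_norm' := fun x => norm_nonneg x }⟩

lemma nonneg (p : CStarSeminorm L) (x : L) : 0 ≤ p.toFun x := apply_nonneg p.toSeminorm x

lemma add_le (p : CStarSeminorm L) (x y : L) : p.toFun (x + y) ≤ p.toFun x + p.toFun y :=
  map_add_le_add p.toSeminorm x y

lemma smul_eq (p : CStarSeminorm L) (c : ℂ) (x : L) : p.toFun (c • x) = ‖c‖ * p.toFun x :=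
  map_smul_eq_mul p.toSeminorm c x

lemma neg_eq (p : CStarSeminorm L) (x : L) : p.toFun (-x) = p.toFun x :=
  map_neg_eq_map p.toSeminorm x

lemma zero_eq (p : CStarSeminorm L) : p.toFun 0 = 0 := map_zero p.toSeminorm

lemma le_star (p : CStarSeminorm L) (x : L) : p.toFun x ≤ p.toFun (star x) := by
  have h1 := p.star_mul_self' x
  have h2 := p.mul_le' (star x) x
  rcases (p.nonneg x).eq_or_lt with h | h
  · rw [← h]
    exact p.nonneg _
  · nlinarith [p.nonneg (star x)]

lemma star_eq (p : CStarSeminorm L) (x : L) : p.toFun (star x) = p.toFun x :=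
  le_antisymm (by simpa using p.le_star (star x)) (p.le_star x)

end CStarSeminorm

section Envelope

variable {L : Type*} [NormedRing L] [NormedAlgebra ℂ L] [StarRing L]

/-- The largest C*-seminorm: the supremum of `‖φ x‖` over all `*`-representations `φ`. -/
def envNorm (x : L) : ℝ := ⨆ p : CStarSeminorm L, p.toFun x

lemma bddAbove_envNorm (x : L) : BddAbove (Set.range fun p : CStarSeminorm L => p.toFun x) :=
  ⟨‖x‖, by
    rintro _ ⟨p, rfl⟩
    exact p.le_norm' x⟩

lemma CStarSeminorm.le_envNorm (p : CStarSeminorm L) (x : L) : p.toFun x ≤ envNorm x :=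
  le_ciSup (bddAbove_envNorm x) p

lemma envNorm_nonneg (x : L) : 0 ≤ envNorm x := Real.iSup_nonneg fun p => p.nonneg x

lemma envNorm_le_norm (x : L) : envNorm x ≤ ‖x‖ := ciSup_le fun p => p.le_norm' x

lemma envNorm_zero : envNorm (0 : L) = 0 := by
  simp only [envNorm, CStarSeminorm.zero_eq, ciSup_const]

lemma envNorm_neg (x : L) : envNorm (-x) = envNorm x := by
  simp only [envNorm, CStarSeminorm.neg_eq]

lemma envNorm_star (x : L) : envNorm (star x) = envNorm x := by
  simp only [envNorm, CStarSeminorm.star_eq]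

lemma envNorm_add_le (x y : L) : envNorm (x + y) ≤ envNorm x + envNorm y :=
  ciSup_le fun p => (p.add_le x y).trans (add_le_add (p.le_envNorm x) (p.le_envNorm y))

lemma envNorm_mul_le (x y : L) : envNorm (x * y) ≤ envNorm x * envNorm y :=
  ciSup_le fun p => (p.mul_le' x y).trans
    (mul_le_mul (p.le_envNorm x) (p.le_envNorm y) (p.nonneg y) (envNorm_nonneg x))

lemma envNorm_smul (c : ℂ) (x : L) : envNorm (c • x) = ‖c‖ * envNorm x := by
  simp only [envNorm, CStarSeminorm.smul_eq]
  exact (Real.mul_iSup_of_nonneg (norm_nonneg c) _).symm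

lemma envNorm_sq_le (x : L) : envNorm x * envNorm x ≤ envNorm (star x * x) := by
  have h : envNorm x ≤ Real.sqrt (envNorm (star x * x)) :=
    ciSup_le fun p => Real.le_sqrt_of_sq_le (by
      rw [← p.star_mul_self' x]
      exact p.le_envNorm _)
  calc envNorm x * envNorm x
      ≤ Real.sqrt (envNorm (star x * x)) * Real.sqrt (envNorm (star x * x)) :=
        mul_self_le_mul_self (envNorm_nonneg x) h
    _ = envNorm (star x * x) := Real.mul_self_sqrt (envNorm_nonneg _)

/-- `L` with the seminorm `envNorm`. -/
def PreEnv (L : Type*) : Type _ := L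

instance : Ring (PreEnv L) := inferInstanceAs (Ring L)
instance : StarRing (PreEnv L) := inferInstanceAs (StarRing L)
instance : Algebra ℂ (PreEnv L) := inferInstanceAs (Algebra ℂ L)
instance [StarModule ℂ L] : StarModule ℂ (PreEnv L) := inferInstanceAs (StarModule ℂ L)

/-- The seminorm `envNorm` as a seminorm of additive groups. -/
def envSeminorm : AddGroupSeminorm (PreEnv L) where
  toFun := fun x => envNorm (L := L) x
  map_zero' := envNorm_zero (L := L)
  add_le' := fun x y => envNorm_add_le (L := L) x y
  neg' := fun x => envNorm_neg (L := L) x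

instance : SeminormedAddCommGroup (PreEnv L) := envSeminorm.toSeminormedAddCommGroup

instance : SeminormedRing (PreEnv L) :=
  { (inferInstance : SeminormedAddCommGroup (PreEnv L)), (inferInstance : Ring (PreEnv L)) with
    norm_mul_le := fun x y => envNorm_mul_le (L := L) x y }

instance : NormedAlgebra ℂ (PreEnv L) where
  norm_smul_le := fun c x => (envNorm_smul (L := L) c x).le

instance : NormedStarGroup (PreEnv L) where
  norm_star_le := fun x => (envNorm_star (L := L) x).le

/-- The (universal) enveloping C*-algebra of `L`: the Hausdorff completion of `L` with respect to
the largest C*-seminorm. -/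
def EnvelopingCStarAlgebra (L : Type*) [NormedRing L] [NormedAlgebra ℂ L] [StarRing L] : Type _ :=
  UniformSpace.Completion (PreEnv L)

namespace EnvelopingCStarAlgebra

open UniformSpace

instance : NormedRing (EnvelopingCStarAlgebra L) :=
  inferInstanceAs (NormedRing (Completion (PreEnv L)))

instance : CompleteSpace (EnvelopingCStarAlgebra L) :=
  inferInstanceAs (CompleteSpace (Completion (PreEnv L)))

instance : Algebra ℂ (EnvelopingCStarAlgebra L) :=
  inferInstanceAs (Algebra ℂ (Completion (PreEnv L)))

/-- The canonical map of `L` into its enveloping C*-algebra. -/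
def of (x : L) : EnvelopingCStarAlgebra L := ((show PreEnv L from x : PreEnv L) : Completion (PreEnv L))

lemma norm_of (x : L) : ‖of x‖ = envNorm x := Completion.norm_coe (E := PreEnv L) x

lemma of_add (x y : L) : of (x + y) = of x + of y := Completion.coe_add (α := PreEnv L) x y

lemma of_mul (x y : L) : of (x * y) = of x * of y := Completion.coe_mul (α := PreEnv L) x y

lemma of_one : of (1 : L) = 1 := rfl

lemma of_zero : of (0 : L) = 0 := rfl

lemma denseRange_of : DenseRange (of : L → EnvelopingCStarAlgebra L) :=
  Completion.denseRange_coe (α := PreEnv L)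

lemma of_smul (c : ℂ) (x : L) : of (c • x) = c • of x :=
  Completion.coe_smul (X := PreEnv L) c x

@[elab_as_elim]
lemma induction_on {P : EnvelopingCStarAlgebra L → Prop} (x : EnvelopingCStarAlgebra L)
    (hc : IsClosed {x | P x}) (h : ∀ y : L, P (of y)) : P x :=
  Completion.induction_on (α := PreEnv L) x hc h

instance : NormedAlgebra ℂ (EnvelopingCStarAlgebra L) where
  norm_smul_le := fun c x => norm_smul_le (α := ℂ) (β := Completion (PreEnv L)) c x

instance : Star (EnvelopingCStarAlgebra L) := ⟨Completion.map (star : PreEnv L → PreEnv L)⟩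

lemma uniformContinuous_star' : UniformContinuous (star : PreEnv L → PreEnv L) :=
  star_isometry.uniformContinuous

lemma of_star (x : L) : of (star x) = star (of x) :=
  (Completion.map_coe (uniformContinuous_star' (L := L)) x).symm

lemma continuous_star' :
    Continuous (star : EnvelopingCStarAlgebra L → EnvelopingCStarAlgebra L) :=
  Completion.continuous_map

instance : StarRing (EnvelopingCStarAlgebra L) where
  star_involutive := fun x => by
    refine induction_on x (isClosed_eq (continuous_star'.comp continuous_star') continuous_id)
      fun y => ?_
    rw [← of_star, ← of_star, star_star]
  star_mul := fun x y => by
    refine induction_on x (isClosed_eq (continuous_star'.comp (continuous_mul_const y))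
      ((continuous_const_mul _).comp continuous_star')) fun a => ?_
    refine induction_on y (isClosed_eq (continuous_star'.comp (continuous_const_mul _))
      ((continuous_mul_const _).comp continuous_star')) fun b => ?_
    rw [← of_mul, ← of_star, ← of_star, ← of_star, ← of_mul, star_mul]
  star_add := fun x y => by
    refine induction_on x (isClosed_eq (continuous_star'.comp (continuous_add_const y))
      ((continuous_add_const _).comp continuous_star')) fun a => ?_
    refine induction_on y (isClosed_eq (continuous_star'.comp (continuous_const_add _))
      ((continuous_const_add _).comp continuous_star')) fun b => ?_
    rw [← of_add, ← of_star, ← of_star, ← of_star, ← of_add, star_add]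

instance [StarModule ℂ L] : CStarAlgebra (EnvelopingCStarAlgebra L) where
  norm_mul_self_le := fun x => by
    refine induction_on x (isClosed_le (by fun_prop)
      (continuous_norm.comp (continuous_star'.mul continuous_id))) fun a => ?_
    rw [← of_star, ← of_mul, norm_of, norm_of]
    exact envNorm_sq_le a
  star_smul := fun c x => by
    refine induction_on x (isClosed_eq (continuous_star'.comp (continuous_const_smul c))
      ((continuous_const_smul _).comp continuous_star')) fun a => ?_
    rw [← of_smul, ← of_star, ← of_star, ← of_smul, star_smul]

end EnvelopingCStarAlgebra

end Envelope

/-! ### Partial automorphisms and partial crossed products -/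

/-- A partial automorphism `θ : I → J` of a commutative unital C*-algebra `C`, where `I` and `J`
are ideals generated by projections. The isomorphism `θ` and its inverse are extended by zero to
the complementary ideals, to endomorphisms `hom` and `inv` of `C`; then `J = hom 1 * C` and
`I = inv 1 * C`. -/
structure PartialAut (C : Type*) [CommCStarAlgebra C] where
  hom : C →⋆ₙₐ[ℂ] C
  inv : C →⋆ₙₐ[ℂ] C
  hom_inv : ∀ c, hom (inv c) = hom 1 * c
  inv_hom : ∀ c, inv (hom c) = inv 1 * c

namespace PartialAut

variable {C : Type*} [CommCStarAlgebra C] (T : PartialAut C)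

/-- The power `θ ^ n`, `n ∈ ℤ`, extended by zero. -/
def pow : ℤ → (C →⋆ₙₐ[ℂ] C)
  | Int.ofNat n => T.hom ^ n
  | Int.negSucc n => T.inv ^ (n + 1)

@[simp] lemma pow_zero_apply (c : C) : T.pow 0 c = c := rfl

lemma pow_natCast (n : ℕ) : T.pow (n : ℤ) = T.hom ^ n := rfl

lemma pow_neg_natCast (n : ℕ) : T.pow (-(n : ℤ)) = T.inv ^ n := by
  cases n with
  | zero => rfl
  | succ n => rfl

/-- The range of `θ ^ n`, which is the domain of `θ ^ (-n)`. -/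
def D (n : ℤ) : Submodule ℂ C where
  carrier := {c | T.pow n 1 * c = c}
  zero_mem' := mul_zero _
  add_mem' := fun {a b} ha hb => by
    simp only [Set.mem_ofPred_eq] at *
    rw [mul_add, ha, hb]
  smul_mem' := fun r a ha => by
    simp only [Set.mem_ofPred_eq] at *
    rw [mul_smul_comm, ha]

lemma mem_D {n : ℤ} {c : C} : c ∈ T.D n ↔ T.pow n 1 * c = c := Iff.rfl

lemma pow_one_mul (n : ℤ) (c : C) : T.pow n 1 * T.pow n c = T.pow n c := by
  rw [← map_mul, one_mul]

lemma hom_pow (m : ℤ) (c : C) : T.hom (T.pow m c) = T.hom 1 * T.pow (m + 1) c := by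
  obtain ⟨n, rfl | rfl⟩ := m.eq_nat_or_neg
  · have h : T.pow ((n : ℤ) + 1) c = T.hom (T.pow n c) := by
      rw [show ((n : ℤ) + 1) = ((n + 1 : ℕ) : ℤ) by push_cast; rfl, pow_natCast, pow_natCast,
        pow_succ']
      rfl
    rw [h, ← map_mul, one_mul]
  · cases n with
    | zero =>
      have h : T.pow (-((0 : ℕ) : ℤ) + 1) c = T.hom c := rfl
      rw [h, ← map_mul, one_mul]
      rfl
    | succ n =>
      rw [show (-((n + 1 : ℕ) : ℤ) + 1) = -(n : ℤ) by push_cast; ring, pow_neg_natCast,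
        pow_neg_natCast, pow_succ', ← T.hom_inv]
      rfl

lemma inv_pow (m : ℤ) (c : C) : T.inv (T.pow m c) = T.inv 1 * T.pow (m - 1) c := by
  obtain ⟨n, rfl | rfl⟩ := m.eq_nat_or_neg
  · cases n with
    | zero =>
      have h : T.pow (((0 : ℕ) : ℤ) - 1) c = T.inv c := rfl
      rw [h, ← map_mul, one_mul]
      rfl
    | succ n =>
      rw [show (((n + 1 : ℕ) : ℤ) - 1) = (n : ℤ) by push_cast; ring, pow_natCast,
        pow_natCast, pow_succ', ← T.inv_hom]
      rfl
  · have h : T.pow (-(n : ℤ) - 1) c = T.inv (T.pow (-(n : ℤ)) c) := by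
      rw [show (-(n : ℤ) - 1) = -((n + 1 : ℕ) : ℤ) by push_cast; ring, pow_neg_natCast,
        pow_neg_natCast, pow_succ']
      rfl
    rw [h, ← map_mul, one_mul]

lemma pow_pow (n m : ℤ) (c : C) : T.pow n (T.pow m c) = T.pow n 1 * T.pow (n + m) c := by
  obtain ⟨k, rfl | rfl⟩ := n.eq_nat_or_neg
  · induction k with
    | zero => simp
    | succ k ih =>
      have h : ∀ c, T.pow ((k + 1 : ℕ) : ℤ) c = T.hom (T.pow k c) := fun c => by
        rw [pow_natCast, pow_natCast, pow_succ']
        rfl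
      have e : (k : ℤ) + m + 1 = ((k + 1 : ℕ) : ℤ) + m := by
        push_cast
        ring
      rw [h, h, ih, map_mul, hom_pow T (k + m), ← mul_assoc, ← map_mul, mul_one, e]
  · induction k with
    | zero => simp
    | succ k ih =>
      have h : ∀ c, T.pow (-((k + 1 : ℕ) : ℤ)) c = T.inv (T.pow (-(k : ℤ)) c) := fun c => by
        rw [pow_neg_natCast, pow_neg_natCast, pow_succ']
        rfl
      have e : -(k : ℤ) + m - 1 = -((k + 1 : ℕ) : ℤ) + m := by
        push_cast
        ring
      rw [h, h, ih, map_mul, inv_pow T (-(k : ℤ) + m), ← mul_assoc, ← map_mul, mul_one, e]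

lemma pow_pow_neg (n : ℤ) (c : C) : T.pow n (T.pow (-n) c) = T.pow n 1 * c := by
  rw [pow_pow, add_neg_cancel, pow_zero_apply]

lemma pow_mem_D (n : ℤ) (c : C) : T.pow n c ∈ T.D n := T.pow_one_mul n c

lemma mem_D_iff_exists {n : ℤ} {c : C} : c ∈ T.D n ↔ ∃ d, T.pow n d = c :=
  ⟨fun h => ⟨T.pow (-n) c, by rw [pow_pow_neg, T.mem_D.1 h]⟩, by
    rintro ⟨d, rfl⟩
    exact T.pow_mem_D n d⟩

lemma mul_mem_D_left {n : ℤ} {c : C} (hc : c ∈ T.D n) (d : C) : c * d ∈ T.D n := by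
  rw [mem_D, ← mul_assoc, T.mem_D.1 hc]

lemma isClosed_D (n : ℤ) : IsClosed (T.D n : Set C) :=
  isClosed_eq (continuous_const_mul _) continuous_id

lemma star_mem_D {n : ℤ} {c : C} (hc : c ∈ T.D n) : star c ∈ T.D n := by
  obtain ⟨d, rfl⟩ := T.mem_D_iff_exists.1 hc
  rw [← map_star]
  exact T.pow_mem_D n _

lemma norm_pow_le (n : ℤ) (c : C) : ‖T.pow n c‖ ≤ ‖c‖ :=
  NonUnitalStarAlgHom.norm_apply_le (T.pow n) c

lemma continuous_pow (n : ℤ) : Continuous (T.pow n) :=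
  AddMonoidHomClass.continuous_of_bound (T.pow n) 1 fun c => by
    simpa using T.norm_pow_le n c

lemma conv_term {k : ℤ} {c : C} (hc : c ∈ T.D k) (d : C) :
    T.pow k (T.pow (-k) c * d) = c * T.pow k d := by
  rw [map_mul, pow_pow_neg, T.mem_D.1 hc]

lemma conv_term_mem {k n : ℤ} {c d : C} (hd : d ∈ T.D (n - k)) :
    c * T.pow k d ∈ T.D n := by
  have h : T.pow k d = T.pow k 1 * T.pow n 1 * T.pow k d := by
    conv_lhs => rw [← T.mem_D.1 hd, map_mul, pow_pow, add_sub_cancel]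
  rw [mem_D, h]
  have h2 : T.pow n 1 * T.pow n 1 = T.pow n 1 := T.pow_one_mul n 1
  linear_combination (c * T.pow k 1 * T.pow k d) * h2

/-- The space `L` of sequences `a ∈ ℓ¹(ℤ, C)` with `a n ∈ D n` for all `n`. -/
def l1Submodule : Submodule ℂ (ℤ → C) where
  carrier := {a | (∀ n, a n ∈ T.D n) ∧ Summable fun n => ‖a n‖}
  zero_mem' := ⟨fun n => (T.D n).zero_mem, by simp⟩
  add_mem' := fun {a b} ha hb => ⟨fun n => (T.D n).add_mem (ha.1 n) (hb.1 n),
    (ha.2.add hb.2).of_nonneg_of_le (fun _ => norm_nonneg _) fun _ => norm_add_le _ _⟩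
  smul_mem' := fun c a ha => ⟨fun n => (T.D n).smul_mem c (ha.1 n), by
    simpa [norm_smul] using ha.2.mul_left ‖c‖⟩

/-- The Banach `*`-algebra `L` of the partial automorphism. -/
def L1 : Type _ := T.l1Submodule

namespace L1

variable {T}

instance : AddCommGroup T.L1 := inferInstanceAs (AddCommGroup T.l1Submodule)
instance : Module ℂ T.L1 := inferInstanceAs (Module ℂ T.l1Submodule)

/-- The `n`-th coefficient `a n` of `a`. -/
def coeff (a : T.L1) (n : ℤ) : C := a.1 n

@[ext] lemma ext {a b : T.L1} (h : ∀ n, a.coeff n = b.coeff n) : a = b :=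
  Subtype.ext (funext h)

lemma coeff_mem (a : T.L1) (n : ℤ) : a.coeff n ∈ T.D n := a.2.1 n

lemma summable_norm (a : T.L1) : Summable fun n => ‖a.coeff n‖ := a.2.2

/-- The element of `L` with given coefficients. -/
def mk (a : ℤ → C) (h1 : ∀ n, a n ∈ T.D n) (h2 : Summable fun n => ‖a n‖) : T.L1 := ⟨a, h1, h2⟩

@[simp] lemma coeff_mk (a : ℤ → C) (h1 : ∀ n, a n ∈ T.D n) (h2 : Summable fun n => ‖a n‖) (n : ℤ) :
    (mk a h1 h2).coeff n = a n := rfl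

@[simp] lemma coeff_zero (n : ℤ) : (0 : T.L1).coeff n = 0 := rfl
@[simp] lemma coeff_add (a b : T.L1) (n : ℤ) : (a + b).coeff n = a.coeff n + b.coeff n := rfl
@[simp] lemma coeff_neg (a : T.L1) (n : ℤ) : (-a).coeff n = -a.coeff n := rfl
@[simp] lemma coeff_smul (c : ℂ) (a : T.L1) (n : ℤ) : (c • a).coeff n = c • a.coeff n := rfl

/-- The norm `‖a‖ = ∑ ‖a n‖`. -/
def l1Norm : AddGroupNorm T.L1 where
  toFun := fun a => ∑' n, ‖a.coeff n‖
  map_zero' := by simp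
  add_le' := fun a b => by
    rw [← a.summable_norm.tsum_add b.summable_norm]
    exact (a + b).summable_norm.tsum_le_tsum (fun n => norm_add_le _ _)
      (a.summable_norm.add b.summable_norm)
  neg' := fun a => by simp
  eq_zero_of_map_eq_zero' := fun a h => by
    ext n
    have h1 : ‖a.coeff n‖ ≤ ∑' n, ‖a.coeff n‖ :=
      a.summable_norm.le_tsum n fun _ _ => norm_nonneg _
    rw [show (∑' n, ‖a.coeff n‖) = 0 from h] at h1
    exact norm_le_zero_iff.1 h1

instance : NormedAddCommGroup T.L1 := l1Norm.toNormedAddCommGroup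

lemma norm_def (a : T.L1) : ‖a‖ = ∑' n, ‖a.coeff n‖ := rfl

lemma norm_coeff_le (a : T.L1) (n : ℤ) : ‖a.coeff n‖ ≤ ‖a‖ :=
  a.summable_norm.le_tsum n fun _ _ => norm_nonneg _

/-- The change of variables `(n, k) ↦ (k, n - k)`. -/
def shear : ℤ × ℤ ≃ ℤ × ℤ where
  toFun p := (p.2, p.1 - p.2)
  invFun p := (p.1 + p.2, p.1)
  left_inv p := by ext <;> simp
  right_inv p := by ext <;> simp

lemma summable_prod_norm (a b : T.L1) :
    Summable fun p : ℤ × ℤ => ‖a.coeff p.2‖ * ‖b.coeff (p.1 - p.2)‖ :=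
  shear.summable_iff.2 (a.summable_norm.mul_of_nonneg b.summable_norm
    (fun _ => norm_nonneg _) fun _ => norm_nonneg _)

lemma tsum_prod_norm (a b : T.L1) :
    ∑' p : ℤ × ℤ, ‖a.coeff p.2‖ * ‖b.coeff (p.1 - p.2)‖ = ‖a‖ * ‖b‖ := by
  rw [norm_def, norm_def, a.summable_norm.tsum_mul_tsum b.summable_norm
    (a.summable_norm.mul_of_nonneg b.summable_norm
      (fun _ => norm_nonneg _) fun _ => norm_nonneg _)]
  exact shear.tsum_eq fun p : ℤ × ℤ => ‖a.coeff p.1‖ * ‖b.coeff p.2‖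

/-- The summand `θ ^ k (θ ^ (-k) (a k) * b (n - k))` of the convolution. -/
def convTerm (a b : T.L1) (n k : ℤ) : C :=
  T.pow k (T.pow (-k) (a.coeff k) * b.coeff (n - k))

lemma convTerm_eq (a b : T.L1) (n k : ℤ) :
    convTerm a b n k = a.coeff k * T.pow k (b.coeff (n - k)) :=
  T.conv_term (a.coeff_mem k) _

lemma norm_convTerm_le (a b : T.L1) (n k : ℤ) :
    ‖convTerm a b n k‖ ≤ ‖a.coeff k‖ * ‖b.coeff (n - k)‖ := by
  rw [convTerm_eq]
  exact (norm_mul_le _ _).trans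
    (mul_le_mul_of_nonneg_left (T.norm_pow_le _ _) (norm_nonneg _))

lemma summable_norm_convTerm (a b : T.L1) (n : ℤ) : Summable fun k => ‖convTerm a b n k‖ :=
  ((summable_prod_norm a b).prod_factor n).of_nonneg_of_le (fun _ => norm_nonneg _)
    fun k => norm_convTerm_le a b n k

lemma summable_convTerm (a b : T.L1) (n : ℤ) : Summable (convTerm a b n) :=
  (summable_norm_convTerm a b n).of_norm

lemma norm_tsum_convTerm_le (a b : T.L1) (n : ℤ) :
    ‖∑' k, convTerm a b n k‖ ≤ ∑' k, ‖a.coeff k‖ * ‖b.coeff (n - k)‖ :=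
  (norm_tsum_le_tsum_norm (summable_norm_convTerm a b n)).trans
    ((summable_norm_convTerm a b n).tsum_le_tsum (fun k => norm_convTerm_le a b n k)
      ((summable_prod_norm a b).prod_factor n))

/-- The convolution product of `L`. -/
instance : Mul T.L1 where
  mul a b := mk (fun n => ∑' k, T.pow k (T.pow (-k) (a.coeff k) * b.coeff (n - k)))
    (fun n => tsum_mem (T.isClosed_D n) fun k => by
      rw [T.conv_term (a.coeff_mem k)]
      exact T.conv_term_mem (b.coeff_mem (n - k)))
    ((summable_prod_norm a b).prod.of_nonneg_of_le (fun _ => norm_nonneg _)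
      fun n => norm_tsum_convTerm_le a b n)

lemma coeff_mul (a b : T.L1) (n : ℤ) :
    (a * b).coeff n = ∑' k, T.pow k (T.pow (-k) (a.coeff k) * b.coeff (n - k)) := rfl

lemma coeff_mul' (a b : T.L1) (n : ℤ) :
    (a * b).coeff n = ∑' k, a.coeff k * T.pow k (b.coeff (n - k)) :=
  tsum_congr fun k => convTerm_eq a b n k

lemma summable_mul' (a b : T.L1) (n : ℤ) :
    Summable fun k => a.coeff k * T.pow k (b.coeff (n - k)) :=
  (summable_convTerm a b n).congr fun k => convTerm_eq a b n k

lemma norm_mul_le' (a b : T.L1) : ‖a * b‖ ≤ ‖a‖ * ‖b‖ := by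
  rw [← tsum_prod_norm a b, (summable_prod_norm a b).tsum_prod, norm_def]
  exact (a * b).summable_norm.tsum_le_tsum (fun n => norm_tsum_convTerm_le a b n)
    (summable_prod_norm a b).prod

/-- The element `c u ^ n` of `L`, for `c ∈ D n`. -/
def mono (n : ℤ) (c : T.D n) : T.L1 :=
  mk (Pi.single n (c : C))
    (fun k => by
      by_cases h : k = n
      · subst h
        simp
      · rw [Pi.single_eq_of_ne h]
        exact (T.D k).zero_mem)
    (summable_of_ne_finset_zero (s := {n}) fun k hk => by
      rw [Pi.single_eq_of_ne (by simpa using hk), norm_zero])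

lemma coeff_mono_self (n : ℤ) (c : T.D n) : (mono n c).coeff n = c := by
  simp [mono]

lemma coeff_mono_of_ne {n k : ℤ} (h : k ≠ n) (c : T.D n) : (mono n c).coeff k = 0 := by
  simp [mono, Pi.single_eq_of_ne h]

lemma mem_D_zero (c : C) : c ∈ T.D 0 := by simp [mem_D]

instance : One T.L1 := ⟨mono 0 ⟨1, mem_D_zero 1⟩⟩

lemma coeff_one_zero : (1 : T.L1).coeff 0 = 1 := coeff_mono_self 0 _

lemma coeff_one_of_ne {k : ℤ} (h : k ≠ 0) : (1 : T.L1).coeff k = 0 := coeff_mono_of_ne h _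

/-- The involution of `L`. -/
instance : Star T.L1 where
  star a := mk (fun n => T.pow n (star (a.coeff (-n)))) (fun n => T.pow_mem_D n _)
    (((Equiv.neg ℤ).summable_iff.2 a.summable_norm).of_nonneg_of_le (fun _ => norm_nonneg _)
      fun n => (T.norm_pow_le n _).trans (norm_star _).le)

lemma coeff_star (a : T.L1) (n : ℤ) : (star a).coeff n = T.pow n (star (a.coeff (-n))) := rfl

lemma one_mul' (a : T.L1) : 1 * a = a := by
  ext n
  rw [coeff_mul', tsum_eq_single 0]
  · rw [coeff_one_zero, one_mul, pow_zero_apply, sub_zero]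
  · intro k hk
    rw [coeff_one_of_ne hk, zero_mul]

lemma mul_one' (a : T.L1) : a * 1 = a := by
  ext n
  rw [coeff_mul', tsum_eq_single n]
  · rw [sub_self, coeff_one_zero, mul_comm, T.mem_D.1 (a.coeff_mem n)]
  · intro k hk
    rw [coeff_one_of_ne (sub_ne_zero.2 hk.symm), map_zero, mul_zero]

lemma add_mul' (a b c : T.L1) : (a + b) * c = a * c + b * c := by
  ext n
  rw [coeff_add, coeff_mul', coeff_mul', coeff_mul',
    ← (summable_mul' a c n).tsum_add (summable_mul' b c n)]
  exact tsum_congr fun k => by rw [coeff_add, add_mul]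

lemma mul_add' (a b c : T.L1) : a * (b + c) = a * b + a * c := by
  ext n
  rw [coeff_add, coeff_mul', coeff_mul', coeff_mul',
    ← (summable_mul' a b n).tsum_add (summable_mul' a c n)]
  exact tsum_congr fun k => by rw [coeff_add, map_add, mul_add]

lemma pow_tsum (k : ℤ) {f : ℤ → C} (hf : Summable f) :
    T.pow k (∑' j, f j) = ∑' j, T.pow k (f j) :=
  hf.map_tsum (T.pow k) (T.continuous_pow k)

lemma summable_triple (a b c : T.L1) (n : ℤ) : Summable fun p : ℤ × ℤ =>
    a.coeff p.2 * T.pow p.2 (b.coeff (p.1 - p.2)) * T.pow p.1 (c.coeff (n - p.1)) := by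
  refine Summable.of_norm ?_
  refine ((summable_prod_norm a b).mul_right ‖c‖).of_nonneg_of_le (fun _ => norm_nonneg _)
    fun p => ?_
  refine (norm_mul_le _ _).trans (mul_le_mul ?_ ((T.norm_pow_le _ _).trans (c.norm_coeff_le _))
    (norm_nonneg _) (by positivity))
  exact (norm_mul_le _ _).trans (mul_le_mul_of_nonneg_left (T.norm_pow_le _ _) (norm_nonneg _))

lemma mul_pow_coeff_mul (a b c : T.L1) (n k : ℤ) :
    a.coeff k * T.pow k ((b * c).coeff (n - k)) =
      ∑' m, a.coeff k * T.pow k (b.coeff (m - k)) * T.pow m (c.coeff (n - m)) := by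
  have hs : Summable fun j => T.pow k (b.coeff j * T.pow j (c.coeff (n - k - j))) :=
    (summable_mul' b c (n - k)).map (T.pow k) (T.continuous_pow k)
  rw [coeff_mul', pow_tsum k (summable_mul' b c _), ← hs.tsum_mul_left (a.coeff k),
    ← (Equiv.subRight k).tsum_eq]
  refine tsum_congr fun m => ?_
  rw [Equiv.subRight_apply, map_mul, pow_pow, show n - k - (m - k) = n - m by ring,
    show k + (m - k) = m by ring]
  have h := T.mem_D.1 (a.coeff_mem k)
  linear_combination (T.pow k (b.coeff (m - k)) * T.pow m (c.coeff (n - m))) * h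

lemma mul_assoc' (a b c : T.L1) : a * b * c = a * (b * c) := by
  ext n
  have h1 : (a * b * c).coeff n =
      ∑' m, ∑' k, a.coeff k * T.pow k (b.coeff (m - k)) * T.pow m (c.coeff (n - m)) := by
    rw [coeff_mul']
    exact tsum_congr fun m => by rw [coeff_mul', (summable_mul' a b m).tsum_mul_right]
  have h2 : (a * (b * c)).coeff n =
      ∑' k, ∑' m, a.coeff k * T.pow k (b.coeff (m - k)) * T.pow m (c.coeff (n - m)) := by
    rw [coeff_mul']
    exact tsum_congr fun k => mul_pow_coeff_mul a b c n k
  rw [h1, h2]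
  exact Summable.tsum_comm
    (f := fun k m => a.coeff k * T.pow k (b.coeff (m - k)) * T.pow m (c.coeff (n - m)))
    ((Equiv.prodComm ℤ ℤ).summable_iff.1 (summable_triple a b c n))

lemma star_mul' (a b : T.L1) : star (a * b) = star b * star a := by
  ext n
  rw [coeff_star, coeff_mul', coeff_mul', tsum_star, pow_tsum n (summable_mul' a b _).star,
    ← (Equiv.addLeft n).tsum_eq fun j => (star b).coeff j * T.pow j ((star a).coeff (n - j))]
  refine tsum_congr fun k => ?_
  rw [Equiv.coe_addLeft]
  beta_reduce
  rw [star_mul, map_mul, ← map_star, pow_pow, coeff_star, coeff_star,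
    pow_pow, show -n - k = -(n + k) by ring, show -(n - (n + k)) = k by ring,
    show n + k + (n - (n + k)) = n by ring]
  have h := T.pow_one_mul n (star (a.coeff k))
  have h2 := T.pow_one_mul (n + k) (star (b.coeff (-(n + k))))
  linear_combination (T.pow (n + k) (star (b.coeff (-(n + k))))) * h -
    (T.pow n (star (a.coeff k))) * h2

instance : Ring T.L1 :=
  { (inferInstance : AddCommGroup T.L1) with
    mul := (· * ·)
    one := 1
    mul_assoc := mul_assoc'
    one_mul := one_mul'
    mul_one := mul_one'
    left_distrib := mul_add'
    right_distrib := add_mul'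
    zero_mul := fun a => by
      ext n
      rw [coeff_mul']
      simp
    mul_zero := fun a => by
      ext n
      rw [coeff_mul']
      simp }

instance : NormedRing T.L1 :=
  { (inferInstance : NormedAddCommGroup T.L1), (inferInstance : Ring T.L1) with
    norm_mul_le := norm_mul_le' }

instance : StarRing T.L1 where
  star_involutive := fun a => by
    ext n
    rw [coeff_star, coeff_star, ← map_star, star_star, neg_neg, pow_pow_neg,
      T.mem_D.1 (a.coeff_mem n)]
  star_mul := star_mul'
  star_add := fun a b => by
    ext n
    simp only [coeff_star, coeff_add, star_add, map_add]

instance : Algebra ℂ T.L1 :=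
  Algebra.ofModule
    (fun r a b => by
      ext n
      rw [coeff_smul, coeff_mul', coeff_mul', ← (summable_mul' a b n).tsum_const_smul r]
      exact tsum_congr fun k => by rw [coeff_smul, smul_mul_assoc])
    (fun r a b => by
      ext n
      rw [coeff_smul, coeff_mul', coeff_mul', ← (summable_mul' a b n).tsum_const_smul r]
      exact tsum_congr fun k => by rw [coeff_smul, map_smul, mul_smul_comm])

instance : NormedAlgebra ℂ T.L1 where
  norm_smul_le := fun r a => by
    rw [norm_def, norm_def, ← a.summable_norm.tsum_mul_left]
    exact (tsum_congr fun n => by rw [coeff_smul, norm_smul]).le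

instance : StarModule ℂ T.L1 where
  star_smul := fun r a => by
    ext n
    rw [coeff_star, coeff_smul, coeff_smul, coeff_star, star_smul, map_smul]

instance : NormedStarGroup T.L1 where
  norm_star_le := fun a => by
    rw [norm_def, norm_def, ← (Equiv.neg ℤ).tsum_eq fun n => ‖a.coeff n‖]
    refine (star a).summable_norm.tsum_le_tsum (fun n => ?_)
      ((Equiv.neg ℤ).summable_iff.2 a.summable_norm)
    exact (T.norm_pow_le n _).trans (norm_star _).le

end L1

/-- The partial crossed product `C ⋊ ℤ`: the enveloping C*-algebra of `L`. -/
abbrev CrossedProduct : Type _ := EnvelopingCStarAlgebra T.L1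

/-- The element `c u ^ n` of the partial crossed product, for `c ∈ D n`. -/
def mono (n : ℤ) (c : T.D n) : T.CrossedProduct := EnvelopingCStarAlgebra.of (L1.mono n c)

/-- The canonical partial isometry `u` of the partial crossed product; as an element of `L`, it is
`1_J u`, where `1_J` is the unit of the ideal `J = D 1`. -/
def u : T.CrossedProduct := T.mono 1 ⟨T.pow 1 1, T.pow_mem_D 1 1⟩

end PartialAut

/-! ### Commutative C*-dynamical systems and their reversible extensions -/

open WeakDual

namespace CommEndo

variable {A : Type*} [CommCStarAlgebra A] (δ : A →⋆ₙₐ[ℂ] A)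

/-- The clopen domain `Δ₁` of the partial mapping of the spectrum of `A` dual to `δ`. -/
def dom : Set (characterSpace ℂ A) := {x | x (δ 1) = 1}

/-- The partial mapping `α : Δ₁ → X`, `α x = x ∘ δ`, dual to the endomorphism `δ`. -/
def dual (x : dom δ) : characterSpace ℂ A :=
  CharacterSpace.equivAlgHom.symm
    { toFun := fun a => x.1 (δ a)
      map_one' := x.2
      map_mul' := fun a b => by rw [map_mul, map_mul]
      map_zero' := by rw [map_zero, map_zero]
      map_add' := fun a b => by rw [map_add, map_add]
      commutes' := fun r => by
        rw [Algebra.algebraMap_eq_smul_one, map_smul, map_smul, show x.1 (δ 1) = 1 from x.2,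
          Algebra.algebraMap_eq_smul_one] }

@[simp] lemma dual_apply (x : dom δ) (a : A) : dual δ x a = x.1 (δ a) := rfl

lemma eval_one_or (x : characterSpace ℂ A) : x (δ 1) = 1 ∨ x (δ 1) = 0 := by
  have h : x (δ 1) * x (δ 1) = x (δ 1) := by rw [← map_mul, ← map_mul, one_mul]
  by_cases h0 : x (δ 1) = 0
  · exact Or.inr h0
  · exact Or.inl (mul_right_cancel₀ h0 (by rw [h, one_mul]))

lemma continuous_eval (a : A) : Continuous fun x : characterSpace ℂ A => x a :=
  (WeakDual.eval_continuous a).comp continuous_subtype_val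

lemma isClopen_dom : IsClopen (dom δ) := by
  refine ⟨isClosed_eq (continuous_eval _) continuous_const, ?_⟩
  have h : dom δ = {x | x (δ 1) ≠ 0} := by
    ext x
    rcases eval_one_or δ x with h | h <;> simp [dom, h]
  rw [h]
  exact isOpen_ne_fun (continuous_eval _) continuous_const

lemma continuous_dual : Continuous (dual δ) := by
  refine Continuous.subtype_mk (WeakDual.continuous_of_continuous_eval fun a => ?_) _
  exact (continuous_eval (δ a)).comp continuous_subtype_val

/-- The domain `Δₙ` of the iterate `α ^ n`. -/
def domIter : ℕ → Set (characterSpace ℂ A)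
  | 0 => Set.univ
  | n + 1 => {x | ∃ h : x ∈ dom δ, dual δ ⟨x, h⟩ ∈ domIter n}

end CommEndo

/-- A commutative unital C*-dynamical system `(A, δ)`, given by an endomorphism `δ` of `A` (which
need not preserve the unit) such that the image `Δ₋₁` of the dual partial mapping `α` of the
spectrum of `A` is open. -/
structure CommDynSystem (A : Type*) [CommCStarAlgebra A] where
  δ : A →⋆ₙₐ[ℂ] A
  isOpen_range : IsOpen (Set.range (CommEndo.dual δ))

namespace CommDynSystem

open CommEndo

variable {A : Type*} [CommCStarAlgebra A] (S : CommDynSystem A)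

/-- The finite anti-orbits `(x₀, …, x_N, 0, 0, …)` ending at a point outside `Δ₋₁`. The symbol `0`
is `Sum.inr ()`. -/
def finOrbits (N : ℕ) : Set (ℕ → characterSpace ℂ A ⊕ Unit) :=
  {x | ∃ y : ℕ → characterSpace ℂ A,
    (∀ n ≤ N, x n = Sum.inl (y n) ∧ y n ∈ domIter S.δ n) ∧
    (∀ n, N < n → x n = Sum.inr ()) ∧
    y N ∉ Set.range (dual S.δ) ∧
    ∀ n < N, ∃ h : y (n + 1) ∈ dom S.δ, dual S.δ ⟨y (n + 1), h⟩ = y n}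

/-- The infinite anti-orbits `(x₀, x₁, …)`. -/
def infOrbits : Set (ℕ → characterSpace ℂ A ⊕ Unit) :=
  {x | ∃ y : ℕ → characterSpace ℂ A,
    (∀ n, x n = Sum.inl (y n) ∧ y n ∈ domIter S.δ n) ∧
    ∀ n, ∃ h : y (n + 1) ∈ dom S.δ, dual S.δ ⟨y (n + 1), h⟩ = y n}

/-- The set of all anti-orbits of `α`, as a subset of `∏ (X ∪ {0})`. -/
def orbits : Set (ℕ → characterSpace ℂ A ⊕ Unit) := (⋃ N, S.finOrbits N) ∪ S.infOrbits

/-- The relation between consecutive terms `p`, `q` of an anti-orbit. -/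
def Link (p q : characterSpace ℂ A ⊕ Unit) : Prop :=
  (∃ z : dom S.δ, p = Sum.inl (dual S.δ z) ∧ q = Sum.inl z.1) ∨
    (q = Sum.inr () ∧ ∀ y, p = Sum.inl y → y ∉ Set.range (dual S.δ))

lemma mem_orbits_iff (x : ℕ → characterSpace ℂ A ⊕ Unit) :
    x ∈ S.orbits ↔ (∃ y, x 0 = Sum.inl y) ∧ ∀ n, S.Link (x n) (x (n + 1)) := by
  constructor
  · rintro (h | ⟨y, hy, hy'⟩)
    · obtain ⟨N, y, h1, h2, h3, h4⟩ := Set.mem_iUnion.1 h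
      refine ⟨⟨y 0, (h1 0 (Nat.zero_le _)).1⟩, fun n => ?_⟩
      rcases lt_trichotomy n N with hn | hn | hn
      · obtain ⟨h, e⟩ := h4 n hn
        exact Or.inl ⟨⟨y (n + 1), h⟩, by rw [e, (h1 n hn.le).1], (h1 (n + 1) hn).1⟩
      · subst hn
        refine Or.inr ⟨h2 _ (Nat.lt_succ_self _), fun z hz => ?_⟩
        rw [(h1 n le_rfl).1] at hz
        rwa [← Sum.inl_injective hz]
      · refine Or.inr ⟨h2 _ (by omega), fun z hz => ?_⟩
        rw [h2 n hn] at hz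
        cases hz
    · refine ⟨⟨y 0, (hy 0).1⟩, fun n => Or.inl ?_⟩
      obtain ⟨h, e⟩ := hy' n
      exact ⟨⟨y (n + 1), h⟩, by rw [e, (hy n).1], (hy (n + 1)).1⟩
  · rintro ⟨⟨y0, h0⟩, hl⟩
    let y : ℕ → characterSpace ℂ A := fun n => Sum.elim id (fun _ => y0) (x n)
    have hy : ∀ n, x n ≠ Sum.inr () → x n = Sum.inl (y n) := fun n hn => by
      rcases h : x n with z | z
      · simp [y, h]
      · exact absurd h hn
    have hstep : ∀ n, x (n + 1) ≠ Sum.inr () → ∃ h : y (n + 1) ∈ dom S.δ,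
        dual S.δ ⟨y (n + 1), h⟩ = y n := fun n hn => by
      rcases hl n with ⟨z, hz, hz'⟩ | ⟨h, -⟩
      · have e1 : y (n + 1) = z := by simp [y, hz']
        have e2 : y n = dual S.δ z := by simp [y, hz]
        refine ⟨by rw [e1]; exact z.2, ?_⟩
        rw [e2]
        congr
      · exact absurd h hn
    have hdom : ∀ n, (∀ m ≤ n, x m ≠ Sum.inr ()) → y n ∈ domIter S.δ n := by
      intro n
      induction n with
      | zero => exact fun _ => Set.mem_univ _
      | succ n ih =>
        intro h
        obtain ⟨h1, h2⟩ := hstep n (h _ le_rfl)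
        exact ⟨h1, by
          rw [h2]
          exact ih fun m hm => h m (hm.trans (Nat.le_succ n))⟩
    by_cases hx : ∃ n, x n = Sum.inr ()
    · classical
      obtain ⟨N, hN, hmin⟩ : ∃ N, x (N + 1) = Sum.inr () ∧ ∀ m ≤ N, x m ≠ Sum.inr () := by
        have hf := Nat.find_spec hx
        have hm := fun m => Nat.find_min hx (m := m)
        rcases h : Nat.find hx with _ | N
        · rw [h, h0] at hf
          cases hf
        · rw [h] at hf hm
          exact ⟨N, hf, fun m h' => hm m (by omega)⟩
      refine Or.inl (Set.mem_iUnion.2 ⟨N, y, fun n hn => ⟨hy n (hmin n hn),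
        hdom n fun m h' => hmin m (h'.trans hn)⟩, ?_, ?_, fun n hn => hstep n (hmin _ hn)⟩)
      · intro n hn
        induction n, hn using Nat.le_induction with
        | base => exact hN
        | succ n _ ih =>
          rcases hl n with ⟨z, hz, -⟩ | ⟨h, -⟩
          · rw [ih] at hz
            cases hz
          · exact h
      · rcases hl N with ⟨z, -, hz⟩ | ⟨-, h⟩
        · rw [hN] at hz
          cases hz
        · exact h _ (hy N (hmin N le_rfl))
    · push Not at hx
      exact Or.inr ⟨y, fun n => ⟨hy n (hx n), hdom n fun m _ => hx m⟩,
        fun n => hstep n (hx _)⟩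

lemma isClosed_link : IsClosed {p : (characterSpace ℂ A ⊕ Unit) × (characterSpace ℂ A ⊕ Unit) |
    S.Link p.1 p.2} := by
  have hc : CompactSpace (dom S.δ) := isCompact_iff_compactSpace.1 (isClopen_dom S.δ).1.isCompact
  have h1 : IsClosed (Set.range fun z : dom S.δ =>
      ((Sum.inl (dual S.δ z) : characterSpace ℂ A ⊕ Unit),
        (Sum.inl z.1 : characterSpace ℂ A ⊕ Unit))) :=
    (isCompact_range ((continuous_inl.comp (continuous_dual S.δ)).prodMk
      (continuous_inl.comp continuous_subtype_val))).isClosed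
  have h2 : IsClosed (((Sum.inl '' Set.range (dual S.δ))ᶜ : Set (characterSpace ℂ A ⊕ Unit)) ×ˢ
      ({Sum.inr ()} : Set (characterSpace ℂ A ⊕ Unit))) :=
    (isOpenMap_inl _ S.isOpen_range).isClosed_compl.prod isClosed_singleton
  convert h1.union h2 using 1
  ext ⟨p, q⟩
  constructor
  · rintro (⟨z, rfl, rfl⟩ | ⟨h, h'⟩)
    · exact Or.inl ⟨z, rfl⟩
    · refine Or.inr ⟨?_, h⟩
      rintro ⟨y, hy, rfl⟩
      exact h' y rfl hy
  · rintro (⟨z, hz⟩ | ⟨h, h'⟩)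
    · obtain ⟨rfl, rfl⟩ := Prod.mk.inj hz
      exact Or.inl ⟨z, rfl, rfl⟩
    · exact Or.inr ⟨h', fun y hy hr => h ⟨y, hr, hy.symm⟩⟩

lemma isClosed_orbits : IsClosed S.orbits := by
  have h : S.orbits = {x | x 0 ∈ Set.range Sum.inl} ∩ ⋂ n, {x | S.Link (x n) (x (n + 1))} := by
    ext x
    rw [mem_orbits_iff, Set.mem_inter_iff, Set.mem_iInter]
    exact and_congr ⟨fun ⟨y, hy⟩ => ⟨y, hy.symm⟩, fun ⟨y, hy⟩ => ⟨y, hy.symm⟩⟩ Iff.rfl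
  rw [h]
  refine (isClosed_range_inl.preimage (continuous_apply 0)).inter (isClosed_iInter fun n => ?_)
  exact IsClosed.preimage (f := fun x : ℕ → characterSpace ℂ A ⊕ Unit => (x n, x (n + 1)))
    ((continuous_apply n).prodMk (continuous_apply (n + 1))) S.isClosed_link

/-- The `α`-extension `X̃` of `X`, with the topology induced from the product `∏ (X ∪ {0})`. -/
def Ext : Type _ := S.orbits

instance : TopologicalSpace S.Ext := inferInstanceAs (TopologicalSpace S.orbits)

instance : CompactSpace S.Ext := isCompact_iff_compactSpace.1 S.isClosed_orbits.isCompact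

instance : T2Space S.Ext := inferInstanceAs (T2Space S.orbits)

variable {S}

namespace Ext

lemma link (x : S.Ext) (n : ℕ) : S.Link (x.1 n) (x.1 (n + 1)) := ((S.mem_orbits_iff _).1 x.2).2 n

lemma isLeft_zero (x : S.Ext) : (x.1 0).isLeft := by
  obtain ⟨y, hy⟩ := ((S.mem_orbits_iff _).1 x.2).1
  rw [hy]
  rfl

/-- The projection `Φ : X̃ → X`, `Φ (x₀, x₁, …) = x₀`. -/
def fst (x : S.Ext) : characterSpace ℂ A := (x.1 0).getLeft x.isLeft_zero

lemma inl_fst (x : S.Ext) : Sum.inl x.fst = x.1 0 := Sum.inl_getLeft _ _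

lemma fst_eq {x : S.Ext} {y : characterSpace ℂ A} (h : x.1 0 = Sum.inl y) : x.fst = y :=
  Sum.inl_injective (x.inl_fst.trans h)

lemma continuous_coord (n : ℕ) : Continuous fun x : S.Ext => x.1 n :=
  (continuous_apply n).comp continuous_subtype_val

lemma continuous_fst : Continuous (fst : S.Ext → _) := by
  rw [Topology.IsEmbedding.inl (Y := Unit).continuous_iff]
  exact (continuous_coord 0).congr fun x => x.inl_fst.symm

end Ext

variable (S)

/-- The clopen set `Δ̃₁ = Φ⁻¹(Δ₁)`. -/
def extDom : Set S.Ext := {x | x.fst ∈ dom S.δ}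

/-- The clopen set `Δ̃₋₁ = Φ⁻¹(Δ₋₁)`. -/
def extRange : Set S.Ext := {x | x.fst ∈ Set.range (dual S.δ)}

lemma isClopen_extDom : IsClopen S.extDom := (isClopen_dom S.δ).preimage Ext.continuous_fst

lemma isClopen_range : IsClopen (Set.range (dual S.δ)) := by
  have hc : CompactSpace (dom S.δ) := isCompact_iff_compactSpace.1 (isClopen_dom S.δ).1.isCompact
  exact ⟨(isCompact_range (continuous_dual S.δ)).isClosed, S.isOpen_range⟩

lemma isClopen_extRange : IsClopen S.extRange := S.isClopen_range.preimage Ext.continuous_fst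

/-- The homeomorphism `α̃ : Δ̃₁ → Δ̃₋₁`, `α̃ (x₀, x₁, …) = (α x₀, x₀, x₁, …)`. -/
def extMap (x : S.extDom) : S.Ext :=
  ⟨fun n => Nat.casesOn n (Sum.inl (dual S.δ ⟨x.1.fst, x.2⟩)) x.1.1, by
    refine (S.mem_orbits_iff _).2 ⟨⟨_, rfl⟩, fun n => ?_⟩
    cases n with
    | zero => exact Or.inl ⟨⟨x.1.fst, x.2⟩, rfl, x.1.inl_fst.symm⟩
    | succ n => exact x.1.link n⟩

lemma exists_of_mem_extRange {x : S.Ext} (hx : x ∈ S.extRange) :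
    ∃ z : dom S.δ, x.1 0 = Sum.inl (dual S.δ z) ∧ x.1 1 = Sum.inl z.1 := by
  rcases x.link 0 with h | ⟨-, h⟩
  · exact h
  · exact absurd hx (h _ x.inl_fst.symm)

/-- The inverse `α̃⁻¹ : Δ̃₋₁ → Δ̃₁`, `α̃⁻¹ (x₀, x₁, x₂, …) = (x₁, x₂, …)`. -/
def extMapInv (x : S.extRange) : S.Ext :=
  ⟨fun n => x.1.1 (n + 1), by
    obtain ⟨z, -, hz⟩ := S.exists_of_mem_extRange x.2
    exact (S.mem_orbits_iff _).2 ⟨⟨_, hz⟩, fun n => x.1.link (n + 1)⟩⟩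

lemma continuous_extMap : Continuous S.extMap := by
  refine Continuous.subtype_mk (continuous_pi fun n => ?_) _
  cases n with
  | zero =>
    exact continuous_inl.comp ((continuous_dual S.δ).comp
      ((Ext.continuous_fst.comp continuous_subtype_val).subtype_mk _))
  | succ n => exact (Ext.continuous_coord n).comp continuous_subtype_val

lemma continuous_extMapInv : Continuous S.extMapInv :=
  Continuous.subtype_mk (continuous_pi fun n =>
    (Ext.continuous_coord (n + 1)).comp continuous_subtype_val) _

lemma extMap_mem (x : S.extDom) : S.extMap x ∈ S.extRange := ⟨⟨x.1.fst, x.2⟩, (Ext.fst_eq rfl).symm⟩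

lemma extMapInv_mem (x : S.extRange) : S.extMapInv x ∈ S.extDom := by
  obtain ⟨z, -, hz⟩ := S.exists_of_mem_extRange x.2
  have h : (S.extMapInv x).fst = z.1 := Ext.fst_eq hz
  change (S.extMapInv x).fst ∈ dom S.δ
  rw [h]
  exact z.2

lemma extMapInv_extMap (x : S.extDom) : S.extMapInv ⟨S.extMap x, S.extMap_mem x⟩ = x.1 := rfl

lemma extMap_extMapInv (x : S.extRange) : S.extMap ⟨S.extMapInv x, S.extMapInv_mem x⟩ = x.1 := by
  obtain ⟨z, hz0, hz⟩ := S.exists_of_mem_extRange x.2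
  refine Subtype.ext (funext fun n => ?_)
  cases n with
  | zero =>
    have h : (S.extMapInv x).fst = z.1 := Ext.fst_eq hz
    change Sum.inl (dual S.δ ⟨(S.extMapInv x).fst, S.extMapInv_mem x⟩) = x.1.1 0
    rw [hz0]
    congr
  | succ n => rfl

end CommDynSystem

open Classical in
/-- For a continuous map `φ : s → Y` on a clopen set `s`, the endomorphism of `C(Y)` that maps `f` to
`f ∘ φ` on `s` and `0` outside `s`. -/
def extendComp {Y : Type*} [TopologicalSpace Y] (s : Set Y) (hs : IsClopen s) (φ : s → Y)
    (hφ : Continuous φ) : C(Y, ℂ) →⋆ₙₐ[ℂ] C(Y, ℂ) where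
  toFun f := ⟨fun y => if h : y ∈ s then f (φ ⟨y, h⟩) else 0, by
    rw [← continuousOn_univ, ← Set.union_compl_self s,
      continuousOn_union_iff_of_isOpen hs.2 hs.compl.2]
    constructor
    · rw [continuousOn_iff_continuous_domRestrict]
      refine (f.continuous.comp hφ).congr fun y => ?_
      simp
    · refine (continuousOn_const (c := (0 : ℂ))).congr fun y hy => ?_
      rw [dif_neg hy]⟩
  map_smul' c f := by
    ext y
    by_cases h : y ∈ s <;> simp [h]
  map_zero' := by
    ext y
    simp
  map_add' f g := by
    ext y
    by_cases h : y ∈ s <;> simp [h]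
  map_mul' f g := by
    ext y
    by_cases h : y ∈ s <;> simp [h]
  map_star' f := by
    ext y
    by_cases h : y ∈ s <;> simp [h]

section extendComp

variable {Y : Type*} [TopologicalSpace Y] {s : Set Y} (hs : IsClopen s) {φ : s → Y}
  (hφ : Continuous φ)

lemma extendComp_of_mem (f : C(Y, ℂ)) {y : Y} (h : y ∈ s) :
    extendComp s hs φ hφ f y = f (φ ⟨y, h⟩) := dif_pos h

lemma extendComp_of_notMem (f : C(Y, ℂ)) {y : Y} (h : y ∉ s) :
    extendComp s hs φ hφ f y = 0 := dif_neg h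

end extendComp

namespace CommDynSystem

open CommEndo

variable {A : Type*} [CommCStarAlgebra A] (S : CommDynSystem A)

/-- The coefficient algebra `B = C(X̃)`. -/
abbrev Coeff : Type _ := C(S.Ext, ℂ)

/-- The partial automorphism `δ̃` of `B = C(X̃)` given by the partial homeomorphism `α̃`. -/
def extAut : PartialAut S.Coeff where
  hom := extendComp S.extDom S.isClopen_extDom S.extMap S.continuous_extMap
  inv := extendComp S.extRange S.isClopen_extRange S.extMapInv S.continuous_extMapInv
  hom_inv := fun f => by
    ext x
    rw [ContinuousMap.mul_apply]
    by_cases h : x ∈ S.extDom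
    · rw [extendComp_of_mem _ _ _ h, extendComp_of_mem _ _ _ h,
        extendComp_of_mem _ _ _ (S.extMap_mem ⟨x, h⟩), extMapInv_extMap]
      simp
    · rw [extendComp_of_notMem _ _ _ h, extendComp_of_notMem _ _ _ h, zero_mul]
  inv_hom := fun f => by
    ext x
    rw [ContinuousMap.mul_apply]
    by_cases h : x ∈ S.extRange
    · rw [extendComp_of_mem _ _ _ h, extendComp_of_mem _ _ _ h,
        extendComp_of_mem _ _ _ (S.extMapInv_mem ⟨x, h⟩), extMap_extMapInv]
      simp
    · rw [extendComp_of_notMem _ _ _ h, extendComp_of_notMem _ _ _ h, zero_mul]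

/-- The covariance algebra `C*(A, δ) = C(X̃) ⋊ ℤ`. -/
abbrev CovarianceAlgebra : Type _ := S.extAut.CrossedProduct

/-- The function `(x₀, x₁, …) ↦ a(x_k)` on `X̃`, where `a(0) = 0`. -/
def coord (k : ℕ) (a : A) : S.Coeff where
  toFun x := Sum.elim (fun y : characterSpace ℂ A => y a) (fun _ => 0) (x.1 k)
  continuous_toFun := ((continuous_eval a).sumElim continuous_const).comp (Ext.continuous_coord k)

/-- The finitely supported sequences `(a₀, a₁, …)` with `a_k` in the ideal `A_k = δ ^ k (1) A`. -/
def seqs : Set (ℕ →₀ A) := {a | ∀ k, ∃ b, a k = (S.δ ^ k) 1 * b}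

/-- The element `[a₀, a₁, …]` of `B`, that is, the function `(x₀, x₁, …) ↦ ∑ a_k(x_k)`. -/
def bracket (a : ℕ →₀ A) : S.Coeff := a.sum fun k c => S.coord k c

/-- The canonical map `a ↦ [a, 0, 0, …] u⁰` of `A` into the covariance algebra. -/
def incl (a : A) : S.CovarianceAlgebra :=
  S.extAut.mono 0 ⟨S.bracket (Finsupp.single 0 a), PartialAut.L1.mem_D_zero _⟩

/-- The ideal of those `a ∈ A = C(X)` that vanish outside a subset `K` of the spectrum `X`. -/
def vanishingOutside (_S : CommDynSystem A) (K : Set (characterSpace ℂ A)) : Set A :=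
  {a | ∀ x ∉ K, x a = 0}

end CommDynSystem

/-- The powers `U ^ n`, `n ∈ ℤ`, of a partial isometry, where `U ^ (-n) = (U*) ^ n`. -/
def partialIsometryPow {H : Type*} [NormedAddCommGroup H] [InnerProductSpace ℂ H] [CompleteSpace H]
    (U : H →L[ℂ] H) : ℤ → (H →L[ℂ] H)
  | Int.ofNat n => U ^ n
  | Int.negSucc n => star U ^ (n + 1)

/-- A covariant representation `(π, U, H)` of the system `(A, δ)` on the Hilbert space `H`: a
representation `π` of `A` on `H` and a partial isometry `U` with initial space
`π(C_{Δ₋₁}(X)) H` and final space `π(C_{Δ₁}(X)) H` such that `U π(a) U* = π(δ(a))`. -/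
structure CovRep {A : Type*} [CommCStarAlgebra A] (S : CommDynSystem A) (H : Type*)
    [NormedAddCommGroup H] [InnerProductSpace ℂ H] [CompleteSpace H] where
  π : A →⋆ₙₐ[ℂ] (H →L[ℂ] H)
  U : H →L[ℂ] H
  isPartialIsometry : U * star U * U = U
  initial : ((LinearMap.ker (U : H →ₗ[ℂ] H))ᗮ : Set H) =
    {v | ∃ a ∈ S.vanishingOutside (Set.range (CommEndo.dual S.δ)), ∃ w, π a w = v}
  final : Set.range U = {v | ∃ a ∈ S.vanishingOutside (CommEndo.dom S.δ), ∃ w, π a w = v}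
  covariant : ∀ a, U * π a * star U = π (S.δ a)

namespace CovRep

variable {A : Type*} [CommCStarAlgebra A] {S : CommDynSystem A} {H : Type*}
    [NormedAddCommGroup H] [InnerProductSpace ℂ H] [CompleteSpace H] (ρ : CovRep S H)

/-- The C*-algebra `C*(π(A), U)` generated by `π(A)` and `U`. -/
def generated : NonUnitalStarSubalgebra ℂ (H →L[ℂ] H) :=
  (NonUnitalStarAlgebra.adjoin ℂ (Set.range ρ.π ∪ {ρ.U})).topologicalClosure

/-- `Ψ` is given by the formula
`Ψ (∑_{|n| ≤ N} a(n) u ^ n) = ∑_{|n| ≤ N} (∑_k U*^k π(a_k^{(n)}) U^k) U^n`,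
where `a(n) = [a_0^{(n)}, a_1^{(n)}, …]` lies in the ideal `D n`. -/
def IsIntegratedForm (Ψ : S.CovarianceAlgebra →⋆ₙₐ[ℂ] (H →L[ℂ] H)) : Prop :=
  ∀ (N : ℕ) (a : ℤ → (ℕ →₀ A)) (_ : ∀ n, a n ∈ S.seqs)
    (hD : ∀ n, S.bracket (a n) ∈ S.extAut.D n),
    Ψ (∑ n ∈ Finset.Icc (-(N : ℤ)) N, S.extAut.mono n ⟨S.bracket (a n), hD n⟩) =
      ∑ n ∈ Finset.Icc (-(N : ℤ)) N,
        ((a n).sum fun k c => star ρ.U ^ k * ρ.π c * ρ.U ^ k) * partialIsometryPow ρ.U n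

end CovRep

end

/-! The algebra `C(X̃)` is governed by generators and relations. The functions `coord k a` generate
it by Stone–Weierstrass. Let `p ∈ A` be the indicator of `Δ₋₁`. A sequence of `*`-homomorphisms `t
k` of `A` into a commutative C*-algebra `D` with `t k (p a) = t (k+1) (δ a)` and `t (k+1) (δ(1) a) =
t (k+1) a` extends to `C(X̃)` (`exists_coeffHom`): a character `y` of `D` turns the `t k` into
points `x_k = y ∘ t k` of `X ∪ {0}`, and the relations say that consecutive points are linked as in
an anti-orbit.

For a covariant representation, the conditions on the initial and final space amount to `U*U = π(p)`
and `UU* = π(δ(1))`. From these, the compressions `a ↦ U*^k π(a) U^k` are multiplicative, commute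
with one another and satisfy the relations, so they assemble to a representation `φ` of `C(X̃)`
(`exists_coeffRep`). As `α̃⁻¹` shifts coordinates, `U* φ(f) U = φ(δ̃⁻¹ f)` holds on generators and
hence everywhere. The pair `(φ, U)` therefore implements `δ̃`, the formula `∑ a(n) u^n ↦ ∑ φ(a(n))
U^n` defines a contractive `*`-homomorphism of `L`, and this passes to the enveloping algebra
(`exists_integratedForm`).

Conversely, `u* coord k a u = coord (k+1) a` in the covariance algebra, so `A` and `u` determine
every representation (`rep_ext`). This gives uniqueness and makes the two constructions mutually
inverse. The range is all of `C*(π(A), U)` because `*`-homomorphisms of C*-algebras have closed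
range. -/

noncomputable section

/-! ### Universal property of the enveloping C*-algebra -/

namespace EnvelopingCStarAlgebra

open UniformSpace

variable {L : Type*} [NormedRing L] [NormedAlgebra ℂ L] [StarRing L]
  {E : Type*} [CStarAlgebra E]

/-- The C*-seminorm `x ↦ ‖φ x‖` of a contractive `*`-homomorphism `φ` into a C*-algebra. -/
def seminormOfHom (φ : L →⋆ₙₐ[ℂ] E) (h : ∀ x, ‖φ x‖ ≤ ‖x‖) : CStarSeminorm L where
  toFun x := ‖φ x‖
  map_zero' := by simp
  add_le' x y := by simpa using norm_add_le (φ x) (φ y)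
  neg' x := by simp
  smul' c x := by simp [norm_smul]
  mul_le' x y := by simpa using norm_mul_le (φ x) (φ y)
  star_mul_self' x := by simp [map_star, CStarRing.norm_star_mul_self, sq]
  le_norm' := h

lemma norm_le_envNorm (φ : L →⋆ₙₐ[ℂ] E) (h : ∀ x, ‖φ x‖ ≤ ‖x‖) (x : L) : ‖φ x‖ ≤ envNorm x :=
  (seminormOfHom φ h).le_envNorm x

/-- The seminorm `x ↦ ‖φ x‖` is one of those in the supremum `envNorm`, so `φ` is uniformly
continuous for `envNorm` and extends to the completion. The algebraic identities persist by density.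
-/
lemma exists_lift (φ : L →⋆ₙₐ[ℂ] E) (h : ∀ x, ‖φ x‖ ≤ ‖x‖) :
    ∃ Ψ : EnvelopingCStarAlgebra L →⋆ₙₐ[ℂ] E, ∀ x, Ψ (of x) = φ x := by
  let f : PreEnv L →+ E := AddMonoidHomClass.toAddMonoidHom φ
  have hf : UniformContinuous f :=
    (AddMonoidHomClass.lipschitz_of_bound f 1 fun x => by
      rw [one_mul]
      exact norm_le_envNorm φ h x).uniformContinuous
  let g : EnvelopingCStarAlgebra L → E := Completion.extension f
  have hg : ∀ x : L, g (of x) = φ x := fun x => Completion.extension_coe hf x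
  have hc : Continuous g := Completion.continuous_extension
  refine ⟨{ toFun := g, map_smul' := ?_, map_zero' := ?_, map_add' := ?_,
            map_mul' := ?_, map_star' := ?_ }, hg⟩
  · intro c x
    refine induction_on x (isClosed_eq (hc.comp (continuous_const_smul c)) (hc.const_smul c))
      fun a => ?_
    rw [← of_smul, hg, hg, map_smul]
    rfl
  · rw [← of_zero, hg, map_zero]
  · intro x y
    refine induction_on x (isClosed_eq (hc.comp (continuous_add_const y))
      (hc.add continuous_const)) fun a => ?_
    refine induction_on y (isClosed_eq (hc.comp (continuous_const_add _))
      (continuous_const.add hc)) fun b => ?_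
    rw [← of_add, hg, hg, hg, map_add]
  · intro x y
    refine induction_on x (isClosed_eq (hc.comp (continuous_mul_const y))
      (hc.mul continuous_const)) fun a => ?_
    refine induction_on y (isClosed_eq (hc.comp (continuous_const_mul _))
      (continuous_const.mul hc)) fun b => ?_
    rw [← of_mul, hg, hg, hg, map_mul]
  · intro x
    refine induction_on x (isClosed_eq (hc.comp continuous_star') hc.star) fun a => ?_
    rw [← of_star, hg, hg, map_star]

end EnvelopingCStarAlgebra

/-! ### Monomials and the partial isometry `u` in a partial crossed product -/

namespace PartialAut

variable {C : Type*} [CommCStarAlgebra C] (T : PartialAut C)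

namespace L1

variable {T}

lemma mono_mul_mono (n m : ℤ) (c : T.D n) (d : T.D m) :
    (mono n c * mono m d : T.L1) =
      mono (n + m) ⟨c * T.pow n d, T.conv_term_mem (by simp [d.2])⟩ := by
  ext k
  rw [coeff_mul', tsum_eq_single n]
  · rw [coeff_mono_self]
    by_cases h : k = n + m
    · subst h
      have e : n + m - n = m := by ring
      rw [coeff_mono_self, congrArg (mono m d).coeff e, coeff_mono_self]
    · rw [coeff_mono_of_ne h, coeff_mono_of_ne (fun h' => h (by omega)), map_zero, mul_zero]
  · intro j hj
    rw [coeff_mono_of_ne hj, zero_mul]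

lemma star_mono (n : ℤ) (c : T.D n) :
    star (mono n c : T.L1) = mono (-n) ⟨T.pow (-n) (star c), T.pow_mem_D _ _⟩ := by
  ext k
  rw [coeff_star]
  by_cases h : k = -n
  · subst h
    rw [coeff_mono_self, neg_neg, coeff_mono_self]
  · rw [coeff_mono_of_ne h, coeff_mono_of_ne (fun h' => h (by omega)), star_zero, map_zero]

lemma coeff_sum {ι : Type*} (s : Finset ι) (f : ι → T.L1) (n : ℤ) :
    (∑ i ∈ s, f i).coeff n = ∑ i ∈ s, (f i).coeff n := by
  classical
  induction s using Finset.induction_on with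
  | empty => simp
  | insert i s hi ih => rw [Finset.sum_insert hi, Finset.sum_insert hi, coeff_add, ih]

/-- The distance from `a` to a partial sum over `s` is the tail `∑ ‖a n‖` over `n ∉ s`. -/
lemma hasSum_mono (a : T.L1) : HasSum (fun n => mono n ⟨a.coeff n, a.coeff_mem n⟩) a := by
  rw [HasSum, SummationFilter.unconditional_filter, tendsto_iff_norm_sub_tendsto_zero]
  refine (tendsto_tsum_compl_atTop_zero fun n => ‖a.coeff n‖).congr fun s => ?_
  rw [← norm_neg, norm_def]
  refine (tsum_subtype {n | n ∉ s} fun n => ‖a.coeff n‖).trans (tsum_congr fun n => ?_)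
  rw [neg_sub, sub_eq_add_neg, coeff_add, coeff_neg, coeff_sum]
  by_cases h : n ∈ s
  · rw [Finset.sum_eq_single n (fun m _ hm => coeff_mono_of_ne hm.symm _)
      (fun h' => absurd h h'), coeff_mono_self, add_neg_cancel, norm_zero]
    exact Set.indicator_of_notMem (s := {n | n ∉ s}) (fun h' => h' h) _
  · rw [Finset.sum_eq_zero fun m hm => coeff_mono_of_ne (ne_of_mem_of_not_mem hm h).symm _,
      neg_zero, add_zero]
    exact Set.indicator_of_mem (s := {n | n ∉ s}) h _

/-- Only additivity is required, so that the lemma also covers maps composed with the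
conjugate-linear involution. -/
lemma addMonoidHom_ext {E : Type*} [AddCommMonoid E] [TopologicalSpace E] [T2Space E]
    {f g : T.L1 →+ E} (hf : Continuous f) (hg : Continuous g)
    (h : ∀ n c, f (mono n c) = g (mono n c)) (a : T.L1) : f a = g a := by
  have hs := (hasSum_mono a).map f hf
  have hs' := (hasSum_mono a).map g hg
  refine hs.unique ?_
  simpa only [Function.comp_def, h] using hs'

end L1

open EnvelopingCStarAlgebra

lemma mono_mul_mono (n m : ℤ) (c : T.D n) (d : T.D m) :
    T.mono n c * T.mono m d = T.mono (n + m) ⟨c * T.pow n d, T.conv_term_mem (by simp [d.2])⟩ := by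
  rw [mono, mono, ← of_mul, L1.mono_mul_mono]
  rfl

lemma star_mono (n : ℤ) (c : T.D n) :
    star (T.mono n c) = T.mono (-n) ⟨T.pow (-n) (star c), T.pow_mem_D _ _⟩ := by
  rw [mono, ← of_star, L1.star_mono]
  rfl

/-- The degree occurs in the type of the coefficient, so degrees that are only propositionally equal
need this transport. -/
lemma mono_congr {n m : ℤ} (h : n = m) {c : T.D n} {d : T.D m} (hcd : (c : C) = d) :
    T.mono n c = T.mono m d := by
  subst h
  rw [Subtype.ext hcd]

lemma mono_zero (n : ℤ) (h : (0 : C) ∈ T.D n) : T.mono n ⟨0, h⟩ = 0 := by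
  rw [mono, ← of_zero]
  congr 1
  ext k
  by_cases hk : k = n
  · subst hk
    rw [L1.coeff_mono_self, L1.coeff_zero]
  · rw [L1.coeff_mono_of_ne hk, L1.coeff_zero]

/-- The canonical embedding `c ↦ c u ^ 0` of the coefficient algebra. -/
def ofCoeff : C →⋆ₙₐ[ℂ] T.CrossedProduct where
  toFun c := T.mono 0 ⟨c, L1.mem_D_zero c⟩
  map_smul' r c := by
    rw [MonoidHom.id_apply, mono, mono, ← of_smul]
    congr 1
    ext k
    by_cases hk : k = 0
    · subst hk
      rw [L1.coeff_smul, L1.coeff_mono_self, L1.coeff_mono_self]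
    · rw [L1.coeff_smul, L1.coeff_mono_of_ne hk, L1.coeff_mono_of_ne hk, smul_zero]
  map_zero' := T.mono_zero 0 _
  map_add' c d := by
    rw [mono, mono, mono, ← of_add]
    congr 1
    ext k
    by_cases hk : k = 0
    · subst hk
      rw [L1.coeff_add, L1.coeff_mono_self, L1.coeff_mono_self, L1.coeff_mono_self]
    · rw [L1.coeff_add, L1.coeff_mono_of_ne hk, L1.coeff_mono_of_ne hk, L1.coeff_mono_of_ne hk,
        add_zero]
  map_mul' c d := by
    rw [mono_mul_mono]
    rfl
  map_star' c := by
    rw [star_mono]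
    rfl

lemma star_u : star T.u = T.mono (-1) ⟨T.inv 1, T.pow_mem_D (-1) 1⟩ := by
  rw [u, star_mono]
  refine T.mono_congr rfl ?_
  rw [← map_star, star_one]
  change T.inv (T.hom 1) = T.inv 1
  rw [T.inv_hom, mul_one]

lemma u_mul_ofCoeff_mul_star_u (c : C) :
    T.u * T.ofCoeff c * star T.u = T.ofCoeff (T.hom c) := by
  rw [star_u, u]
  change _ * T.mono 0 _ * _ = T.mono 0 _
  rw [mono_mul_mono, mono_mul_mono]
  refine T.mono_congr (by norm_num) ?_
  change T.hom 1 * T.hom c * T.hom (T.inv 1) = T.hom c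
  rw [T.hom_inv, mul_one, ← map_mul, ← map_mul, one_mul, mul_one]

lemma star_u_mul_ofCoeff_mul_u (c : C) :
    star T.u * T.ofCoeff c * T.u = T.ofCoeff (T.inv c) := by
  rw [star_u, u]
  change _ * T.mono 0 _ * _ = T.mono 0 _
  rw [mono_mul_mono, mono_mul_mono]
  refine T.mono_congr (by norm_num) ?_
  change T.inv 1 * T.inv c * T.inv (T.hom 1) = T.inv c
  rw [T.inv_hom, mul_one, ← map_mul, ← map_mul, one_mul, mul_one]

lemma u_mul_star_u : T.u * star T.u = T.ofCoeff (T.hom 1) := by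
  rw [star_u, u]
  change _ = T.mono 0 _
  rw [mono_mul_mono]
  refine T.mono_congr (by norm_num) ?_
  change T.hom 1 * T.hom (T.inv 1) = T.hom 1
  rw [T.hom_inv, mul_one, ← map_mul, mul_one]

lemma star_u_mul_u : star T.u * T.u = T.ofCoeff (T.inv 1) := by
  rw [star_u, u]
  change _ = T.mono 0 _
  rw [mono_mul_mono]
  refine T.mono_congr (by norm_num) ?_
  change T.inv 1 * T.inv (T.hom 1) = T.inv 1
  rw [T.inv_hom, mul_one, ← map_mul, mul_one]

lemma u_mul_star_u_mul_u : T.u * star T.u * T.u = T.u := by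
  rw [u_mul_star_u, u]
  change T.mono 0 _ * _ = _
  rw [mono_mul_mono]
  refine T.mono_congr (by norm_num) ?_
  change T.hom 1 * T.hom 1 = T.hom 1
  rw [← map_mul, mul_one]

/-- In positive degree `u ^ n` is the monomial with coefficient `θ ^ n (1)`, the unit of `D n`,
which any `c ∈ D n` absorbs. -/
lemma ofCoeff_mul_u_pow (n : ℕ) (c : T.D n) :
    T.ofCoeff (c : C) * T.u ^ n = T.mono n c := by
  have h : ∀ n : ℕ, T.u ^ (n + 1) = T.mono ((n + 1 : ℕ) : ℤ) ⟨_, T.pow_mem_D _ 1⟩ := fun n => by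
    induction n with
    | zero => rw [zero_add, pow_one, u]; rfl
    | succ n ih =>
      rw [pow_succ, ih, u, mono_mul_mono]
      refine T.mono_congr (by push_cast; ring) ?_
      change T.pow _ 1 * T.pow _ (T.pow 1 1) = _
      rw [T.pow_one_mul]
      change (T.hom ^ (n + 1)) (T.hom 1) = (T.hom ^ (n + 1 + 1)) 1
      rw [pow_succ _ (n + 1)]
      rfl
  cases n with
  | zero => rw [pow_zero, mul_one]; rfl
  | succ n =>
    rw [h]
    change T.mono 0 _ * _ = _
    rw [mono_mul_mono]
    refine T.mono_congr (zero_add _) ?_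
    change (c : C) * T.pow ((n + 1 : ℕ) : ℤ) 1 = c
    rw [mul_comm]
    exact c.2

section

variable {T} {E : Type*} [CStarAlgebra E]

lemma _root_.NonUnitalStarAlgHom.continuous {F G : Type*} [NonUnitalCStarAlgebra F]
    [NonUnitalCStarAlgebra G] (φ : F →⋆ₙₐ[ℂ] G) : Continuous φ :=
  AddMonoidHomClass.continuous_of_bound φ 1 fun x => by
    rw [one_mul]
    exact NonUnitalStarAlgHom.norm_apply_le φ x

/-- The composite of `σ` with `L → C ⋊ ℤ` is contractive for the `ℓ¹` norm, since `envNorm` is at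
most that norm. It therefore preserves the monomial expansion. -/
lemma hasSum_hom_mono (σ : T.CrossedProduct →⋆ₙₐ[ℂ] E) (a : T.L1) :
    HasSum (fun n => σ (T.mono n ⟨a.coeff n, a.coeff_mem n⟩)) (σ (of a)) := by
  let f : T.L1 →+ E := AddMonoidHom.mk' (fun a => σ (of a)) fun a b => by rw [of_add, map_add]
  refine (L1.hasSum_mono a).map f (AddMonoidHomClass.continuous_of_bound f 1 fun x => ?_)
  rw [one_mul]
  exact (NonUnitalStarAlgHom.norm_apply_le σ _).trans ((norm_of x).trans_le (envNorm_le_norm x))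

lemma hom_mem_of_forall_mono {σ : T.CrossedProduct →⋆ₙₐ[ℂ] E} {M : Submodule ℂ E}
    (hM : IsClosed (M : Set E)) (h : ∀ n c, σ (T.mono n c) ∈ M) (x : T.CrossedProduct) :
    σ x ∈ M :=
  induction_on x (hM.preimage σ.continuous) fun a =>
    hM.mem_of_tendsto (hasSum_hom_mono σ a)
      (Filter.Eventually.of_forall fun _ => M.sum_mem fun n _ => h n _)

lemma hom_ext {σ σ' : T.CrossedProduct →⋆ₙₐ[ℂ] E}
    (h : ∀ n c, σ (T.mono n c) = σ' (T.mono n c)) : σ = σ' := by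
  refine DFunLike.ext _ _ fun x => ?_
  refine induction_on x (isClosed_eq σ.continuous σ'.continuous) fun a => ?_
  refine (hasSum_hom_mono σ a).unique ?_
  simp only [h]
  exact hasSum_hom_mono σ' a

/-- Monomials of degree `n ≥ 0` are products `c * u ^ n`; those of negative degree are adjoints of
such products. -/
lemma hom_ext_of_u {σ σ' : T.CrossedProduct →⋆ₙₐ[ℂ] E}
    (h : ∀ c, σ (T.ofCoeff c) = σ' (T.ofCoeff c)) (hu : σ T.u = σ' T.u) : σ = σ' := by
  -- A representation need not be unital, so `τ (u ^ n) = τ u ^ n` may fail for `n = 0`. The left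
  -- factor `x` removes the problem.
  have hp : ∀ (τ : T.CrossedProduct →⋆ₙₐ[ℂ] E) (x : T.CrossedProduct) (n : ℕ),
      τ (x * T.u ^ n) = τ x * τ T.u ^ n := fun τ x n => by
    induction n with
    | zero => simp
    | succ n ih => rw [pow_succ, pow_succ, ← mul_assoc, map_mul, ih, mul_assoc]
  have hn : ∀ (n : ℕ) c, σ (T.mono n c) = σ' (T.mono n c) := fun n c => by
    rw [← ofCoeff_mul_u_pow, hp, hp, h, hu]
  refine hom_ext fun n c => ?_
  obtain ⟨n, rfl | rfl⟩ := n.eq_nat_or_neg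
  · exact hn n c
  · rw [← star_star (T.mono _ c), map_star, map_star σ', star_mono,
      T.mono_congr (neg_neg _) (d := ⟨_, T.pow_mem_D n _⟩) (by rw [neg_neg]), hn]

end

/-! ### Integrated form of a covariant pair -/

section IntegratedForm

variable {H : Type*} [NormedAddCommGroup H] [InnerProductSpace ℂ H] [CompleteSpace H]

lemma _root_.partialIsometryPow_natCast (V : H →L[ℂ] H) (n : ℕ) :
    partialIsometryPow V (n : ℤ) = V ^ n := rfl

lemma _root_.partialIsometryPow_neg_natCast (V : H →L[ℂ] H) (n : ℕ) :
    partialIsometryPow V (-(n : ℤ)) = star V ^ n := by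
  cases n with
  | zero => rfl
  | succ n => rfl

lemma _root_.star_partialIsometryPow (V : H →L[ℂ] H) (n : ℤ) :
    star (partialIsometryPow V n) = partialIsometryPow V (-n) := by
  obtain ⟨n, rfl | rfl⟩ := n.eq_nat_or_neg
  · rw [partialIsometryPow_neg_natCast, partialIsometryPow_natCast, star_pow]
  · rw [partialIsometryPow_neg_natCast, neg_neg, partialIsometryPow_natCast, star_pow, star_star]

/-- `V*V` is a projection, so the C*-identity makes `‖V‖²` equal to its own square. -/
lemma _root_.norm_le_one_of_partialIsometry {V : H →L[ℂ] H} (h : V * star V * V = V) :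
    ‖V‖ ≤ 1 := by
  have h1 : star (star V * V) * (star V * V) = star V * V := by
    rw [star_mul, star_star, mul_assoc, ← mul_assoc V, h]
  have h2 := CStarRing.norm_star_mul_self (x := star V * V)
  rw [h1, CStarRing.norm_star_mul_self] at h2
  by_contra! hV
  have h3 : 1 < ‖V‖ * ‖V‖ := one_lt_mul_of_lt_of_le hV hV.le
  nlinarith

lemma _root_.norm_partialIsometryPow_le {V : H →L[ℂ] H} (h : V * star V * V = V) (n : ℤ) :
    ‖partialIsometryPow V n‖ ≤ 1 := by
  have hn : ∀ (W : H →L[ℂ] H), ‖W‖ ≤ 1 → ∀ n : ℕ, ‖W ^ n‖ ≤ 1 := fun W hW n => by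
    induction n with
    | zero => exact ContinuousLinearMap.norm_id_le
    | succ n ih =>
      rw [pow_succ]
      exact (norm_mul_le _ _).trans (mul_le_one₀ ih (norm_nonneg _) hW)
  have hV := norm_le_one_of_partialIsometry h
  obtain ⟨n, rfl | rfl⟩ := n.eq_nat_or_neg
  · exact hn V hV n
  · rw [partialIsometryPow_neg_natCast]
    exact hn _ ((norm_star V).trans_le hV) n

/-- A representation `φ` of `C` and a partial isometry `V` that implements the partial
automorphism `T`. -/
structure IsCovariantPair (T : PartialAut C) (φ : C →⋆ₙₐ[ℂ] (H →L[ℂ] H)) (V : H →L[ℂ] H) :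
    Prop where
  isPartialIsometry : V * star V * V = V
  mul_star : V * star V = φ (T.hom 1)
  star_mul : star V * V = φ (T.inv 1)
  conj_inv : ∀ c, star V * φ c * V = φ (T.inv c)

namespace IsCovariantPair

variable {T} {φ : C →⋆ₙₐ[ℂ] (H →L[ℂ] H)} {V : H →L[ℂ] H} (h : T.IsCovariantPair φ V)
include h

/-- Applying `conj_inv` to `T.hom c` gives `V* φ(T.hom c) V = V*V φ(c)`. Conjugating back by `V`
costs nothing, because `VV* = φ(T.hom 1)` acts as a unit on `φ(T.hom c)`. -/
lemma conj_hom (c : C) : V * φ c * star V = φ (T.hom c) := by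
  have h1 := h.conj_inv (T.hom c)
  rw [T.inv_hom, map_mul, ← h.star_mul] at h1
  have h2 : V * (star V * φ (T.hom c) * V) * star V = φ (T.hom c) := by
    calc V * (star V * φ (T.hom c) * V) * star V
        = (V * star V) * φ (T.hom c) * (V * star V) := by simp only [mul_assoc]
      _ = φ (T.hom c) := by
        rw [h.mul_star, ← map_mul, ← map_mul, ← map_mul, ← map_mul, one_mul, mul_one]
  rw [← h2, h1, ← mul_assoc, ← mul_assoc, h.isPartialIsometry]

lemma star_isPartialIsometry : star V * V * star V = star V := by
  have h1 := congrArg star h.isPartialIsometry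
  rwa [StarMul.star_mul, StarMul.star_mul, star_star, ← mul_assoc] at h1

/-- The projection `V*V = φ(T.inv 1)` commutes with `φ(c)` and is absorbed by `V`. -/
lemma mul_map (c : C) : V * φ c = φ (T.hom c) * V := by
  rw [← h.conj_hom, mul_assoc, h.star_mul, mul_assoc, ← map_mul, mul_comm c, map_mul, ← h.star_mul,
    ← mul_assoc, ← mul_assoc, h.isPartialIsometry]

lemma star_mul_map (c : C) : star V * φ c = φ (T.inv c) * star V := by
  rw [← h.conj_inv, mul_assoc _ V, h.mul_star, mul_assoc, ← map_mul, mul_comm c, map_mul,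
    ← h.mul_star, ← mul_assoc, ← mul_assoc, h.star_isPartialIsometry]

lemma pow_mul_map (n : ℤ) (c : C) :
    partialIsometryPow V n * φ c = φ (T.pow n c) * partialIsometryPow V n := by
  obtain ⟨n, rfl | rfl⟩ := n.eq_nat_or_neg
  · rw [partialIsometryPow_natCast, pow_natCast]
    induction n with
    | zero => rw [pow_zero, one_mul, mul_one]; rfl
    | succ n ih =>
      rw [pow_succ', mul_assoc, ih, ← mul_assoc, h.mul_map, mul_assoc, pow_succ' T.hom]
      rfl
  · rw [partialIsometryPow_neg_natCast, pow_neg_natCast]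
    induction n with
    | zero => rw [pow_zero, one_mul, mul_one]; rfl
    | succ n ih =>
      rw [pow_succ', mul_assoc, ih, ← mul_assoc, h.star_mul_map, mul_assoc, pow_succ' T.inv]
      rfl

/-- Exponents add only up to a projection: `V V*^(n+1)` is `VV* V*^n`. For `m ≥ 0` the projection is
absorbed through `VV*V = V`. -/
lemma mul_pow (m : ℤ) :
    V * partialIsometryPow V m = φ (T.hom 1) * partialIsometryPow V (m + 1) := by
  rw [← h.mul_star]
  obtain ⟨n, rfl | rfl⟩ := m.eq_nat_or_neg
  · rw [show (n : ℤ) + 1 = ((n + 1 : ℕ) : ℤ) by push_cast; rfl, partialIsometryPow_natCast,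
      partialIsometryPow_natCast, pow_succ', ← mul_assoc, h.isPartialIsometry]
  · cases n with
    | zero =>
      change V * 1 = V * star V * V
      rw [h.isPartialIsometry, mul_one]
    | succ n =>
      rw [show -((n + 1 : ℕ) : ℤ) + 1 = -(n : ℤ) by push_cast; ring,
        partialIsometryPow_neg_natCast, partialIsometryPow_neg_natCast, pow_succ', mul_assoc]

lemma star_mul_pow (m : ℤ) :
    star V * partialIsometryPow V m = φ (T.inv 1) * partialIsometryPow V (m - 1) := by
  rw [← h.star_mul]
  obtain ⟨n, rfl | rfl⟩ := m.eq_nat_or_neg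
  · cases n with
    | zero =>
      change star V * 1 = star V * V * star V
      rw [h.star_isPartialIsometry, mul_one]
    | succ n =>
      rw [show ((n + 1 : ℕ) : ℤ) - 1 = (n : ℤ) by push_cast; ring,
        partialIsometryPow_natCast, partialIsometryPow_natCast, pow_succ', mul_assoc]
  · rw [show -(n : ℤ) - 1 = -((n + 1 : ℕ) : ℤ) by push_cast; ring, partialIsometryPow_neg_natCast,
      partialIsometryPow_neg_natCast, pow_succ', ← mul_assoc, h.star_isPartialIsometry]

/-- For `k ≠ 0` the product `V^k V^j` differs from `V^(k+j)` by the projection `φ(θ^k(1))`, and `c ∈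
D k` absorbs it. This is what makes the integrated form multiplicative on monomials. -/
lemma map_mul_pow_mul_pow {k : ℤ} {c : C} (hc : c ∈ T.D k) (j : ℤ) :
    φ c * partialIsometryPow V k * partialIsometryPow V j =
      φ c * partialIsometryPow V (k + j) := by
  -- The exponent starts at `1`: `V^0` is the identity operator, whereas `φ(1)` may be a proper
  -- projection.
  have hn : ∀ n : ℕ, partialIsometryPow V (n + 1 : ℕ) * partialIsometryPow V j =
      φ (T.pow (n + 1 : ℕ) 1) * partialIsometryPow V ((n + 1 : ℕ) + j) := fun n => by
    induction n with
    | zero =>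
      rw [zero_add, Nat.cast_one, add_comm]
      change V ^ 1 * _ = φ (T.hom 1) * _
      rw [pow_one, h.mul_pow]
    | succ n ih =>
      rw [partialIsometryPow_natCast, pow_succ', mul_assoc, ← partialIsometryPow_natCast, ih,
        ← mul_assoc, h.mul_map, mul_assoc, h.mul_pow, ← mul_assoc, ← map_mul, ← map_mul, mul_one,
        pow_natCast, pow_natCast, pow_succ' _ (n + 1)]
      congr 2
      push_cast
      ring
  have hn' : ∀ n : ℕ, partialIsometryPow V (-(n + 1 : ℕ)) * partialIsometryPow V j =
      φ (T.pow (-(n + 1 : ℕ)) 1) * partialIsometryPow V (-(n + 1 : ℕ) + j) := fun n => by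
    induction n with
    | zero =>
      rw [zero_add, Nat.cast_one, add_comm]
      change (star V) ^ 1 * _ = φ (T.inv 1) * _
      rw [pow_one, h.star_mul_pow]
      rfl
    | succ n ih =>
      rw [partialIsometryPow_neg_natCast, pow_succ', mul_assoc, ← partialIsometryPow_neg_natCast,
        ih, ← mul_assoc, h.star_mul_map, mul_assoc, h.star_mul_pow, ← mul_assoc, ← map_mul,
        ← map_mul, mul_one, pow_neg_natCast, pow_neg_natCast, pow_succ' _ (n + 1)]
      congr 2
      push_cast
      ring
  have hc' : φ c * φ (T.pow k 1) = φ c := by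
    rw [← map_mul, mul_comm, T.mem_D.1 hc]
  obtain ⟨n, rfl | rfl⟩ := k.eq_nat_or_neg
  · cases n with
    | zero =>
      change φ c * 1 * _ = φ c * partialIsometryPow V (0 + j)
      rw [mul_one, zero_add]
    | succ n => rw [mul_assoc, hn, ← mul_assoc, hc']
  · cases n with
    | zero =>
      change φ c * 1 * _ = φ c * partialIsometryPow V (0 + j)
      rw [mul_one, zero_add]
    | succ n => rw [mul_assoc, hn', ← mul_assoc, hc']

lemma norm_term_le (a : T.L1) (n : ℤ) :
    ‖φ (a.coeff n) * partialIsometryPow V n‖ ≤ ‖a.coeff n‖ :=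
  (norm_mul_le _ _).trans ((mul_le_mul (NonUnitalStarAlgHom.norm_apply_le φ _)
    (norm_partialIsometryPow_le h.isPartialIsometry n) (norm_nonneg _) (norm_nonneg _)).trans_eq
      (mul_one _))

lemma summable_term (a : T.L1) : Summable fun n => φ (a.coeff n) * partialIsometryPow V n :=
  .of_norm (a.summable_norm.of_nonneg_of_le (fun _ => norm_nonneg _) (h.norm_term_le a))

lemma exists_l1Hom : ∃ Ψ : T.L1 →⋆ₙₐ[ℂ] (H →L[ℂ] H), (∀ a, ‖Ψ a‖ ≤ ‖a‖) ∧
    ∀ n (c : T.D n), Ψ (L1.mono n c) = φ c * partialIsometryPow V n := by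
  let f : T.L1 →ₗ[ℂ] (H →L[ℂ] H) :=
    { toFun := fun a => ∑' n, φ (a.coeff n) * partialIsometryPow V n
      map_add' := fun a b => by
        rw [← (h.summable_term a).tsum_add (h.summable_term b)]
        exact tsum_congr fun n => by rw [L1.coeff_add, map_add, add_mul]
      map_smul' := fun r a => by
        rw [← (h.summable_term a).tsum_const_smul]
        exact tsum_congr fun n => by
          rw [L1.coeff_smul, map_smul, smul_mul_assoc, RingHom.id_apply] }
  have hf : ∀ a, ‖f a‖ ≤ ‖a‖ := fun a =>
    tsum_of_norm_bounded a.summable_norm.hasSum (h.norm_term_le a)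
  have hm : ∀ n (c : T.D n), f (L1.mono n c) = φ c * partialIsometryPow V n := fun n c => by
    refine (tsum_eq_single n fun k hk => ?_).trans ?_
    · rw [L1.coeff_mono_of_ne hk, map_zero, zero_mul]
    · rw [L1.coeff_mono_self]
  have hc : Continuous f := AddMonoidHomClass.continuous_of_bound f 1 fun x => by
    rw [one_mul]
    exact hf x
  -- Multiplicativity on monomials is `φ(c) V^n φ(d) V^m = φ(c θ^n(d)) V^(n+m)`. It extends by
  -- continuity in the right factor first, then in the left one.
  have hmm : ∀ n (c : T.D n) a, f (L1.mono n c * a) = f (L1.mono n c) * f a := fun n c =>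
    L1.addMonoidHom_ext (f := f.toAddMonoidHom.comp (AddMonoidHom.mulLeft _))
      (g := (AddMonoidHom.mulLeft _).comp f.toAddMonoidHom) (hc.comp (continuous_const_mul _))
      ((continuous_const_mul _).comp hc) fun m d => by
        change f (_ * _) = f _ * f _
        rw [L1.mono_mul_mono, hm, hm, hm,
          ← h.map_mul_pow_mul_pow (T.mul_mem_D_left c.2 (T.pow n d)), map_mul,
          mul_assoc (φ (c : C)),
          ← h.pow_mul_map]
        simp only [mul_assoc]
  have hmul : ∀ b a, f (a * b) = f a * f b := fun b =>
    L1.addMonoidHom_ext (f := f.toAddMonoidHom.comp (AddMonoidHom.mulRight _))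
      (g := (AddMonoidHom.mulRight _).comp f.toAddMonoidHom) (hc.comp (continuous_mul_const _))
      ((continuous_mul_const _).comp hc) fun m d => hmm m d b
  have hstar : ∀ a, f (star a) = star (f a) :=
    L1.addMonoidHom_ext (f := f.toAddMonoidHom.comp (starAddEquiv : T.L1 ≃+ T.L1).toAddMonoidHom)
      (g := (starAddEquiv : (H →L[ℂ] H) ≃+ _).toAddMonoidHom.comp f.toAddMonoidHom)
      (hc.comp continuous_star) (continuous_star.comp hc) fun n c => by
        change f (star _) = star (f _)
        rw [L1.star_mono, hm, hm, StarMul.star_mul, star_partialIsometryPow, ← map_star,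
          h.pow_mul_map]
  exact ⟨{ f with
    map_zero' := map_zero f
    map_mul' := fun a b => hmul b a
    map_star' := hstar }, hf, hm⟩

lemma exists_integratedForm : ∃ Ψ : T.CrossedProduct →⋆ₙₐ[ℂ] (H →L[ℂ] H),
    ∀ n (c : T.D n), Ψ (T.mono n c) = φ c * partialIsometryPow V n := by
  obtain ⟨Ψ, h1, h2⟩ := h.exists_l1Hom
  obtain ⟨Ψ', h'⟩ := EnvelopingCStarAlgebra.exists_lift Ψ h1
  exact ⟨Ψ', fun n c => (h' _).trans (h2 n c)⟩

end IsCovariantPair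

end IntegratedForm

end PartialAut

/-! ### Closed range of `*`-homomorphisms -/

namespace NonUnitalStarAlgHom

variable {F G : Type*} [CStarAlgebra F] [CStarAlgebra G] (φ : F →⋆ₙₐ[ℂ] G)

/-- Truncation of real numbers to `[-r, r]`. -/
def _root_.Real.truncate (r t : ℝ) : ℝ := max (-r) (min t r)

/-- Truncate `x` at height `‖φ x‖` by functional calculus. Since `φ` commutes with the calculus and
the truncation is the identity on the spectrum of `φ x`, the image is unchanged. The non-unital
calculus is used because `φ` need not preserve the unit. -/
lemma exists_selfAdjoint_norm_le {x : F} (hx : IsSelfAdjoint x) :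
    ∃ y : F, φ y = φ x ∧ ‖y‖ ≤ ‖φ x‖ := by
  have hc : Continuous (Real.truncate ‖φ x‖) := by unfold Real.truncate; fun_prop
  have h0 : Real.truncate ‖φ x‖ 0 = 0 := by
    simp [Real.truncate]
  have hφx : IsSelfAdjoint (φ x) := hx.map φ
  refine ⟨cfcₙ (Real.truncate ‖φ x‖) x, ?_, ?_⟩
  · rw [NonUnitalStarAlgHom.map_cfcₙ φ _ x hc.continuousOn h0 φ.continuous hx hφx]
    conv_rhs => rw [← cfcₙ_id ℝ (φ x)]
    refine cfcₙ_congr fun t ht => ?_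
    have h1 : ‖t‖ ≤ ‖φ x‖ :=
      NonUnitalIsometricContinuousFunctionalCalculus.norm_quasispectrum_le (φ x) ht
    rw [Real.norm_eq_abs, abs_le] at h1
    simp [Real.truncate, h1.1, h1.2]
  · refine norm_cfcₙ_le fun t _ => ?_
    rw [Real.norm_eq_abs, abs_le]
    exact ⟨le_max_left _ _, max_le (by linarith [norm_nonneg (φ x)]) (min_le_right _ _)⟩

/-- Real and imaginary parts are lifted separately, whence the factor `2`. -/
lemma exists_norm_le (x : F) : ∃ y : F, φ y = φ x ∧ ‖y‖ ≤ 2 * ‖φ x‖ := by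
  obtain ⟨y, hy, hy'⟩ := φ.exists_selfAdjoint_norm_le (realPart x).2
  obtain ⟨z, hz, hz'⟩ := φ.exists_selfAdjoint_norm_le (imaginaryPart x).2
  refine ⟨y + Complex.I • z, ?_, ?_⟩
  · rw [map_add, map_smul, hy, hz, ← map_smul, ← map_add, realPart_add_I_smul_imaginaryPart]
  · have h1 : ‖φ (realPart x : F)‖ ≤ ‖φ x‖ := by
      have : φ (realPart x : F) = realPart (φ x) := by
        simp [realPart_apply_coe, ← Complex.coe_smul]
        exact map_star φ x
      rw [this]
      exact realPart.norm_le (φ x)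
    have h2 : ‖φ (imaginaryPart x : F)‖ ≤ ‖φ x‖ := by
      have : φ (imaginaryPart x : F) = imaginaryPart (φ x) := by
        simp [imaginaryPart_apply_coe, ← Complex.coe_smul, smul_sub]
        exact map_star φ x
      rw [this]
      exact imaginaryPart.norm_le (φ x)
    calc ‖y + Complex.I • z‖ ≤ ‖y‖ + ‖Complex.I • z‖ := norm_add_le _ _
      _ = ‖y‖ + ‖z‖ := by rw [norm_smul, Complex.norm_I, one_mul]
      _ ≤ 2 * ‖φ x‖ := by linarith

/-- The range of a `*`-homomorphism between C*-algebras is closed. -/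
lemma isClosed_range : IsClosed (Set.range φ) := by
  let f : NormedAddGroupHom F G := AddMonoidHom.mkNormedAddGroupHom φ 1 fun x => by
    rw [one_mul]
    exact NonUnitalStarAlgHom.norm_apply_le φ x
  have hf : f.SurjectiveOnWith f.range 2 := by
    rintro _ ⟨x, rfl⟩
    exact φ.exists_norm_le x
  have h := controlled_closure_of_complete two_pos one_pos hf
  refine isClosed_of_closure_subset fun y hy => ?_
  obtain ⟨x, hx, -⟩ := h y hy
  exact ⟨x, hx⟩

end NonUnitalStarAlgHom

open WeakDual

/-! ### Generators and relations for the coefficient algebra `C(X̃)` -/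

namespace CommDynSystem

open CommEndo

variable {A : Type*} [CommCStarAlgebra A] (S : CommDynSystem A)

/-- The projection of `A` that is the indicator function of the clopen set `Δ₋₁`. -/
def rangeProj : A :=
  (gelfandStarTransform A).symm ⟨Set.indicator (Set.range (dual S.δ)) 1,
    (continuous_const (y := (1 : ℂ))).indicator fun x hx => by
      rw [S.isClopen_range.frontier_eq] at hx
      exact absurd hx (Set.notMem_empty x)⟩

lemma ext_eval {a b : A} (h : ∀ x : characterSpace ℂ A, x a = x b) : a = b :=
  (gelfandStarTransform A).injective (ContinuousMap.ext h)

lemma eval_rangeProj (x : characterSpace ℂ A) :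
    x S.rangeProj = Set.indicator (Set.range (dual S.δ)) 1 x := by
  have h : (gelfandStarTransform A) S.rangeProj x = x S.rangeProj := rfl
  rw [← h, rangeProj, StarAlgEquiv.apply_symm_apply]
  rfl

lemma eval_rangeProj_of_mem {x : characterSpace ℂ A} (h : x ∈ Set.range (dual S.δ)) :
    x S.rangeProj = 1 := by
  rw [eval_rangeProj, Set.indicator_of_mem h, Pi.one_apply]

lemma eval_rangeProj_of_notMem {x : characterSpace ℂ A} (h : x ∉ Set.range (dual S.δ)) :
    x S.rangeProj = 0 := by
  rw [eval_rangeProj, Set.indicator_of_notMem h]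

lemma eval_δ_one_of_notMem {x : characterSpace ℂ A} (h : x ∉ dom S.δ) : x (S.δ 1) = 0 :=
  (eval_one_or S.δ x).resolve_left h

lemma eval_δ_of_notMem {x : characterSpace ℂ A} (h : x ∉ dom S.δ) (a : A) : x (S.δ a) = 0 := by
  rw [← one_mul a, map_mul, map_mul, S.eval_δ_one_of_notMem h, zero_mul]

lemma rangeProj_mul_self : S.rangeProj * S.rangeProj = S.rangeProj := by
  refine ext_eval fun x => ?_
  rw [map_mul]
  by_cases h : x ∈ Set.range (dual S.δ)
  · rw [S.eval_rangeProj_of_mem h, one_mul]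
  · rw [S.eval_rangeProj_of_notMem h, zero_mul]

lemma star_rangeProj : star S.rangeProj = S.rangeProj := by
  refine ext_eval fun x => ?_
  rw [map_star]
  by_cases h : x ∈ Set.range (dual S.δ)
  · rw [S.eval_rangeProj_of_mem h, star_one]
  · rw [S.eval_rangeProj_of_notMem h, star_zero]

/-- The ideal is generated by a projection, so the space it spans in a representation is the range
of a single operator. -/
lemma mem_vanishingOutside_range {a : A} :
    a ∈ S.vanishingOutside (Set.range (dual S.δ)) ↔ S.rangeProj * a = a := by
  constructor
  · intro h
    refine ext_eval fun x => ?_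
    rw [map_mul]
    by_cases hx : x ∈ Set.range (dual S.δ)
    · rw [S.eval_rangeProj_of_mem hx, one_mul]
    · rw [h x hx, mul_zero]
  · intro h x hx
    rw [← h, map_mul, S.eval_rangeProj_of_notMem hx, zero_mul]

lemma mem_vanishingOutside_dom {a : A} : a ∈ S.vanishingOutside (dom S.δ) ↔ S.δ 1 * a = a := by
  constructor
  · intro h
    refine ext_eval fun x => ?_
    rw [map_mul]
    by_cases hx : x ∈ dom S.δ
    · rw [show x (S.δ 1) = 1 from hx, one_mul]
    · rw [h x hx, mul_zero]
  · intro h x hx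
    rw [← h, map_mul, S.eval_δ_one_of_notMem hx, zero_mul]

/-- Evaluation of `a` at a point of `X ∪ {0}`, where `a(0) = 0`. -/
def evalSum (q : characterSpace ℂ A ⊕ Unit) (a : A) : ℂ :=
  Sum.elim (fun y : characterSpace ℂ A => y a) (fun _ => 0) q

lemma coord_apply (k : ℕ) (a : A) (x : S.Ext) : S.coord k a x = evalSum (x.1 k) a := rfl

@[simp] lemma evalSum_inl (x : characterSpace ℂ A) (a : A) : evalSum (Sum.inl x) a = x a := rfl

@[simp] lemma evalSum_inr (i : Unit) (a : A) : evalSum (Sum.inr i) a = 0 := rfl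

/-- Evaluation at `1` separates the adjoined point `0` from the characters. -/
lemma evalSum_ext {p q : characterSpace ℂ A ⊕ Unit} (h : ∀ a, evalSum p a = evalSum q a) :
    p = q := by
  rcases p with x | ⟨⟩ <;> rcases q with y | ⟨⟩
  · exact congrArg Sum.inl (CharacterSpace.ext h)
  · have h1 := h 1
    rw [evalSum_inl, evalSum_inr, map_one] at h1
    exact absurd h1 one_ne_zero
  · have h1 := h 1
    rw [evalSum_inl, evalSum_inr, map_one] at h1
    exact absurd h1 zero_ne_one
  · rfl

lemma continuous_evalSum (a : A) :
    Continuous fun q : characterSpace ℂ A ⊕ Unit => evalSum q a :=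
  (continuous_eval a).sumElim continuous_const

/-- The space `X ∪ {0}` is compact and the evaluations separate its points, so it embeds in the
product `ℂ^A`. -/
lemma continuous_of_continuous_evalSum {Y : Type*} [TopologicalSpace Y]
    {f : Y → characterSpace ℂ A ⊕ Unit} (h : ∀ a, Continuous fun y => evalSum (f y) a) :
    Continuous f := by
  have he : Topology.IsClosedEmbedding
      (fun (q : characterSpace ℂ A ⊕ Unit) (a : A) => evalSum q a) :=
    Continuous.isClosedEmbedding (continuous_pi fun a => continuous_evalSum a) fun p q hpq =>
      evalSum_ext fun a => congrFun hpq a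
  rw [he.isEmbedding.continuous_iff]
  exact continuous_pi h

/-- The functions `a ↦ a(x_k)` as a `*`-homomorphism of `A` into the coefficient algebra. -/
def coordHom (k : ℕ) : A →⋆ₙₐ[ℂ] S.Coeff where
  toFun := S.coord k
  map_smul' c a := by
    ext x
    rw [ContinuousMap.smul_apply, coord_apply, coord_apply]
    rcases x.1 k with y | ⟨⟩ <;> simp
  map_zero' := by
    ext x
    rw [ContinuousMap.zero_apply, coord_apply]
    rcases x.1 k with y | ⟨⟩ <;> simp
  map_add' a b := by
    ext x
    rw [ContinuousMap.add_apply, coord_apply, coord_apply, coord_apply]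
    rcases x.1 k with y | ⟨⟩ <;> simp
  map_mul' a b := by
    ext x
    rw [ContinuousMap.mul_apply, coord_apply, coord_apply, coord_apply]
    rcases x.1 k with y | ⟨⟩ <;> simp
  map_star' a := by
    ext x
    rw [ContinuousMap.star_apply, coord_apply, coord_apply]
    rcases x.1 k with y | ⟨⟩
    · simp [map_star]
    · simp

lemma coord_zero_one : S.coord 0 1 = 1 := by
  ext x
  rw [coord_apply, ← x.inl_fst, evalSum_inl, map_one, ContinuousMap.one_apply]

lemma bracket_single (k : ℕ) (a : A) : S.bracket (Finsupp.single k a) = S.coord k a :=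
  Finsupp.sum_single_index (map_zero (S.coordHom k))

/-- The zeroth coordinate of `α̃ x` is `α(x₀)`, and `δ(a)` vanishes off `Δ₁`: thus `δ̃` extends `δ`.
-/
lemma extAut_hom_coord_zero (a : A) : S.extAut.hom (S.coord 0 a) = S.coord 0 (S.δ a) := by
  ext x
  rw [coord_apply, ← x.inl_fst, evalSum_inl]
  by_cases h : x ∈ S.extDom
  · exact extendComp_of_mem S.isClopen_extDom S.continuous_extMap _ h
  · rw [S.eval_δ_of_notMem h]
    exact extendComp_of_notMem S.isClopen_extDom S.continuous_extMap _ h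

lemma extAut_hom_one : S.extAut.hom 1 = S.coord 0 (S.δ 1) := by
  rw [← S.coord_zero_one, extAut_hom_coord_zero]

/-- The inverse of `α̃` is the left shift of sequences, which moves each copy of `A` to the next. -/
lemma extAut_inv_coord (k : ℕ) (a : A) : S.extAut.inv (S.coord k a) = S.coord (k + 1) a := by
  ext x
  rw [coord_apply]
  by_cases h : x ∈ S.extRange
  · exact extendComp_of_mem S.isClopen_extRange S.continuous_extMapInv _ h
  · refine (extendComp_of_notMem S.isClopen_extRange S.continuous_extMapInv _ h).trans ?_
    -- If `x₀ ∉ Δ₋₁`, the anti-orbit is `(x₀, 0, 0, …)`, so both sides vanish at `x`.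
    have hx : ∀ n, x.1 (n + 1) = Sum.inr () := fun n => by
      induction n with
      | zero =>
        rcases x.link 0 with ⟨z, hz, -⟩ | ⟨h', -⟩
        · exact absurd ⟨z, (Ext.fst_eq hz).symm⟩ h
        · exact h'
      | succ n ih =>
        rcases x.link (n + 1) with ⟨z, hz, -⟩ | ⟨h', -⟩
        · rw [ih] at hz
          cases hz
        · exact h'
    rw [hx, evalSum_inr]

lemma extAut_inv_one : S.extAut.inv 1 = S.coord 0 S.rangeProj := by
  ext x
  rw [coord_apply, ← x.inl_fst, evalSum_inl]
  by_cases h : x ∈ S.extRange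
  · rw [S.eval_rangeProj_of_mem h]
    exact extendComp_of_mem S.isClopen_extRange S.continuous_extMapInv _ h
  · rw [S.eval_rangeProj_of_notMem h]
    exact extendComp_of_notMem S.isClopen_extRange S.continuous_extMapInv _ h

/-- Stone–Weierstrass: two anti-orbits that differ do so in some coordinate `k`, where some `a ∈ A`
tells them apart. -/
lemma topologicalClosure_adjoin_coord :
    (StarAlgebra.adjoin ℂ {f : S.Coeff | ∃ k a, S.coord k a = f}).topologicalClosure = ⊤ := by
  refine ContinuousMap.starSubalgebra_topologicalClosure_eq_top_of_separatesPoints _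
    fun x y hxy => ?_
  by_contra! h
  refine hxy (Subtype.ext (funext fun k => evalSum_ext fun a => ?_))
  exact h _ ⟨S.coord k a, StarAlgebra.subset_adjoin ℂ _ ⟨k, a, rfl⟩, rfl⟩

lemma map_mem_of_forall_coord {E : Type*} [NonUnitalCStarAlgebra E] {φ : S.Coeff →⋆ₙₐ[ℂ] E}
    {M : NonUnitalStarSubalgebra ℂ E} (hM : IsClosed (M : Set E))
    (h : ∀ k a, φ (S.coord k a) ∈ M) (f : S.Coeff) : φ f ∈ M := by
  have hf : f ∈
      (StarAlgebra.adjoin ℂ {f : S.Coeff | ∃ k a, S.coord k a = f}).topologicalClosure := by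
    rw [topologicalClosure_adjoin_coord]
    trivial
  refine closure_minimal (fun g hg => ?_) (hM.preimage φ.continuous) hf
  change φ g ∈ M
  induction hg using StarAlgebra.adjoin_induction with
  | mem g hg =>
    obtain ⟨k, a, rfl⟩ := hg
    exact h k a
  | algebraMap r =>
    -- Neither `φ` nor `M` is unital; constants are covered because the unit of `C(X̃)` is itself
    -- the generator `coord 0 1`.
    rw [Algebra.algebraMap_eq_smul_one, map_smul, ← coord_zero_one]
    exact SMulMemClass.smul_mem r (h 0 1)
  | add f g _ _ hf hg =>
    rw [map_add]
    exact add_mem hf hg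
  | mul f g _ _ hf hg =>
    rw [map_mul]
    exact mul_mem hf hg
  | star f _ hf =>
    rw [map_star]
    exact star_mem hf

lemma coeffHom_ext {E : Type*} [NonUnitalCStarAlgebra E] {φ ψ : S.Coeff →⋆ₙₐ[ℂ] E}
    (h : ∀ k a, φ (S.coord k a) = ψ (S.coord k a)) : φ = ψ := by
  refine DFunLike.ext _ _ fun f => ?_
  have hf : f ∈
      (StarAlgebra.adjoin ℂ {f : S.Coeff | ∃ k a, S.coord k a = f}).topologicalClosure := by
    rw [topologicalClosure_adjoin_coord]
    trivial
  refine closure_minimal (fun g hg => ?_) (isClosed_eq φ.continuous ψ.continuous) hf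
  change φ g = ψ g
  induction hg using StarAlgebra.adjoin_induction with
  | mem g hg =>
    obtain ⟨k, a, rfl⟩ := hg
    exact h k a
  | algebraMap r =>
    rw [Algebra.algebraMap_eq_smul_one, map_smul, map_smul, ← coord_zero_one, h]
  | add f g _ _ hf hg => rw [map_add, map_add, hf, hg]
  | mul f g _ _ hf hg => rw [map_mul, map_mul, hf, hg]
  | star f _ hf => rw [map_star, map_star, hf]

section Universal

variable {D : Type*} [CommCStarAlgebra D] (t : ℕ → (A →⋆ₙₐ[ℂ] D))

lemma map_one_eq_one_or (y : characterSpace ℂ D) (k : ℕ) : y (t k 1) = 1 ∨ y (t k 1) = 0 := by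
  have h : y (t k 1) * y (t k 1) = y (t k 1) := by rw [← map_mul, ← map_mul, one_mul]
  by_cases h0 : y (t k 1) = 0
  · exact Or.inr h0
  · exact Or.inl (mul_right_cancel₀ h0 (by rw [h, one_mul]))

/-- The functional `y ∘ t k` is multiplicative, and its value at `1` is `1` or `0`. It is a
character in the first case and zero in the second, where the point `0` represents it. -/
lemma exists_evalSum_eq (y : characterSpace ℂ D) (k : ℕ) :
    ∃ q : characterSpace ℂ A ⊕ Unit, ∀ a, evalSum q a = y (t k a) := by
  rcases map_one_eq_one_or t y k with h | h
  · exact ⟨Sum.inl (CharacterSpace.equivAlgHom.symm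
      { toFun := fun a => y (t k a)
        map_one' := h
        map_mul' := fun a b => by rw [map_mul, map_mul]
        map_zero' := by rw [map_zero, map_zero]
        map_add' := fun a b => by rw [map_add, map_add]
        commutes' := fun r => by
          rw [Algebra.algebraMap_eq_smul_one, map_smul, map_smul, h,
            Algebra.algebraMap_eq_smul_one] }), fun a => rfl⟩
  · refine ⟨Sum.inr (), fun a => ?_⟩
    rw [← one_mul a, map_mul, map_mul, h, zero_mul, evalSum_inr]

/-- The point of `X ∪ {0}` at which the evaluation is `a ↦ y (t k a)`. -/
def pull (y : characterSpace ℂ D) (k : ℕ) : characterSpace ℂ A ⊕ Unit :=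
  (exists_evalSum_eq t y k).choose

lemma evalSum_pull (y : characterSpace ℂ D) (k : ℕ) (a : A) : evalSum (pull t y k) a = y (t k a) :=
  (exists_evalSum_eq t y k).choose_spec a

variable {S t}

/-- Write `x_k` for the pulled-back points. If `x_{k+1} ∈ X`, then `h2` at `1` puts it in `Δ₁`, and
`h1` gives `p(x_k) = 1` and then `x_k = α(x_{k+1})`. If `x_{k+1} = 0`, then `h1` at `1` excludes
`x_k ∈ Δ₋₁`. -/
lemma link_pull (h1 : ∀ k a, t k (S.rangeProj * a) = t (k + 1) (S.δ a))
    (h2 : ∀ k a, t (k + 1) (S.δ 1 * a) = t (k + 1) a) (y : characterSpace ℂ D) (k : ℕ) :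
    S.Link (pull t y k) (pull t y (k + 1)) := by
  have e1 : ∀ a, evalSum (pull t y k) (S.rangeProj * a) = evalSum (pull t y (k + 1)) (S.δ a) :=
    fun a => by rw [evalSum_pull, evalSum_pull, h1]
  have e2 : ∀ a, evalSum (pull t y (k + 1)) (S.δ 1 * a) = evalSum (pull t y (k + 1)) a :=
    fun a => by rw [evalSum_pull, evalSum_pull, h2]
  rcases hq : pull t y (k + 1) with x | ⟨⟩
  · rw [hq] at e1 e2
    have hx : x ∈ dom S.δ := by
      have := e2 1
      rw [mul_one, evalSum_inl, evalSum_inl, map_one x] at this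
      exact this
    refine Or.inl ⟨⟨x, hx⟩, evalSum_ext fun a => ?_, rfl⟩
    have h3 := e1 1
    have h4 := e1 a
    rw [evalSum_inl, mul_one, show x (S.δ 1) = 1 from hx] at h3
    rcases hp : pull t y k with z | ⟨⟩
    · rw [hp, evalSum_inl] at h3 h4
      rw [map_mul, h3, one_mul] at h4
      exact h4
    · rw [hp, evalSum_inr] at h3
      exact absurd h3 zero_ne_one
  · refine Or.inr ⟨rfl, fun z hz hzr => ?_⟩
    have h3 := e1 1
    rw [hz, hq, evalSum_inl, evalSum_inr, mul_one, S.eval_rangeProj_of_mem hzr] at h3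
    exact one_ne_zero h3

/-- The universal property of `C(X̃)`: it is generated by the copies `coord k` of `A`, subject to
the relations that `h1` and `h2` express. -/
lemma exists_coeffHom (h1 : ∀ k a, t k (S.rangeProj * a) = t (k + 1) (S.δ a))
    (h2 : ∀ k a, t (k + 1) (S.δ 1 * a) = t (k + 1) a) :
    ∃ φ : S.Coeff →⋆ₙₐ[ℂ] D, ∀ k a, φ (S.coord k a) = t k a := by
  classical
  -- The homomorphism sought need not be unital. Characters outside `s` have `x₀ = 0` and give no
  -- point of `X̃`; there the image is set to zero.
  let s : Set (characterSpace ℂ D) := {y | y (t 0 1) = 1}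
  have hs : IsClopen s := by
    refine ⟨isClosed_eq (continuous_eval _) continuous_const, ?_⟩
    have h : s = {y | y (t 0 1) ≠ 0} := by
      ext y
      rcases map_one_eq_one_or t y 0 with h | h <;> simp [s, h]
    rw [h]
    exact isOpen_ne_fun (continuous_eval _) continuous_const
  have hmem : ∀ y : s, pull t y.1 ∈ S.orbits := fun y => by
    refine (S.mem_orbits_iff _).2 ⟨?_, link_pull h1 h2 y.1⟩
    rcases hq : pull t y.1 0 with x | ⟨⟩
    · exact ⟨x, rfl⟩
    · have h := evalSum_pull t y.1 0 1
      rw [hq, evalSum_inr, show y.1 (t 0 1) = 1 from y.2] at h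
      exact absurd h zero_ne_one
  let g : s → S.Ext := fun y => ⟨pull t y.1, hmem y⟩
  have hg : Continuous g := by
    refine Continuous.subtype_mk (continuous_pi fun k =>
      continuous_of_continuous_evalSum fun a => ?_) _
    simp only [evalSum_pull]
    exact (continuous_eval _).comp continuous_subtype_val
  let ψ : S.Coeff →⋆ₙₐ[ℂ] C(characterSpace ℂ D, ℂ) :=
    { toFun := fun f => ⟨fun y => if h : y ∈ s then f (g ⟨y, h⟩) else 0, by
        rw [← continuousOn_univ, ← Set.union_compl_self s,
          continuousOn_union_iff_of_isOpen hs.2 hs.compl.2]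
        constructor
        · rw [continuousOn_iff_continuous_domRestrict]
          refine (f.continuous.comp hg).congr fun y => ?_
          simp
        · refine (continuousOn_const (c := (0 : ℂ))).congr fun y hy => ?_
          rw [dif_neg hy]⟩
      map_smul' := fun c f => by
        ext y
        by_cases h : y ∈ s <;> simp [h]
      map_zero' := by
        ext y
        simp
      map_add' := fun f f' => by
        ext y
        by_cases h : y ∈ s <;> simp [h]
      map_mul' := fun f f' => by
        ext y
        by_cases h : y ∈ s <;> simp [h]
      map_star' := fun f => by
        ext y
        by_cases h : y ∈ s <;> simp [h] }
  have hψ : ∀ k a, ψ (S.coord k a) = gelfandStarTransform D (t k a) := fun k a => by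
    ext y
    change (if h : y ∈ s then S.coord k a (g ⟨y, h⟩) else 0) = y (t k a)
    by_cases h : y ∈ s
    · rw [dif_pos h]
      exact evalSum_pull t y k a
    · rw [dif_neg h, ← evalSum_pull]
      -- Outside `s` the sequence begins with `0`, and a link out of `0` leads only to `0`. Hence
      -- every `t k a` vanishes at `y`, in agreement with extension by zero.
      have hn : ∀ n, pull t y n = Sum.inr () := fun n => by
        induction n with
        | zero =>
          rcases hq : pull t y 0 with x | ⟨⟩
          · have h' := evalSum_pull t y 0 1
            rw [hq, evalSum_inl, map_one] at h'
            exact absurd h'.symm h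
          · rfl
        | succ n ih =>
          rcases link_pull h1 h2 y n with ⟨z, hz, -⟩ | ⟨h', -⟩
          · rw [ih] at hz
            cases hz
          · exact h'
      rw [hn, evalSum_inr]
  refine ⟨((gelfandStarTransform D).symm : C(characterSpace ℂ D, ℂ) →⋆ₙₐ[ℂ] D).comp ψ,
    fun k a => ?_⟩
  change (gelfandStarTransform D).symm (ψ (S.coord k a)) = t k a
  rw [hψ, StarAlgEquiv.symm_apply_apply]

end Universal

end CommDynSystem

/-! ### Initial and final projections of a partial isometry -/

section Projections

variable {H : Type*} [NormedAddCommGroup H] [InnerProductSpace ℂ H] [CompleteSpace H]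

/-- Equal ranges give `PQ = Q` and `QP = P`; the adjoint of the first is `QP = Q`. -/
lemma eq_of_range_eq_of_projection {P Q : H →L[ℂ] H} (hP : star P = P) (hP' : P * P = P)
    (hQ : star Q = Q) (hQ' : Q * Q = Q) (h : Set.range P = Set.range Q) : P = Q := by
  have key : ∀ {P Q : H →L[ℂ] H}, P * P = P → Set.range P = Set.range Q → P * Q = Q :=
    fun {P Q} hP h => by
      ext v
      obtain ⟨w, hw⟩ : Q v ∈ Set.range P := h ▸ Set.mem_range_self v
      rw [mul_apply_eq_comp, ← hw, ← mul_apply_eq_comp, hP]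
  have h1 := congrArg star (key hP' h)
  rw [star_mul, hP, hQ, key hQ' h.symm] at h1
  exact h1

/-- For `v ⟂ ker U`, the vector `v - U*U v` lies both in `ker U` and in its orthogonal complement.
-/
lemma range_star_mul_self {U : H →L[ℂ] H} (hU : U * star U * U = U) :
    Set.range (star U * U : H →L[ℂ] H) = ((LinearMap.ker (U : H →ₗ[ℂ] H))ᗮ : Set H) := by
  have h1 : ∀ w, (star U * U) w ∈ (LinearMap.ker (U : H →ₗ[ℂ] H))ᗮ := fun w => by
    rw [Submodule.mem_orthogonal]
    intro k hk
    have hk' : U k = 0 := hk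
    rw [mul_apply_eq_comp, ContinuousLinearMap.star_eq_adjoint,
      ContinuousLinearMap.adjoint_inner_right, hk', inner_zero_left]
  ext v
  constructor
  · rintro ⟨w, rfl⟩
    exact h1 w
  · intro hv
    refine ⟨v, ?_⟩
    have h2 : v - (star U * U) v ∈ LinearMap.ker (U : H →ₗ[ℂ] H) := by
      change U (v - (star U * U) v) = 0
      rw [map_sub, ← mul_apply_eq_comp, ← mul_assoc, hU, sub_self]
    have h3 := (LinearMap.ker (U : H →ₗ[ℂ] H))ᗮ.sub_mem hv (h1 v)
    have h4 := Submodule.mem_orthogonal _ _ |>.1 h3 _ h2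
    exact (sub_eq_zero.1 (inner_self_eq_zero.1 h4)).symm

lemma range_mul_star_self {U : H →L[ℂ] H} (hU : U * star U * U = U) :
    Set.range (U * star U : H →L[ℂ] H) = Set.range U := by
  ext v
  constructor
  · rintro ⟨w, rfl⟩
    exact ⟨star U w, rfl⟩
  · rintro ⟨w, rfl⟩
    refine ⟨U w, ?_⟩
    rw [← mul_apply_eq_comp, hU]

end Projections

/-! ### Compressions `U*^k π(a) U^k` and the representation of `C(X̃)` -/

namespace CovRep

open CommDynSystem

variable {A : Type*} [CommCStarAlgebra A] {S : CommDynSystem A} {H : Type*}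
    [NormedAddCommGroup H] [InnerProductSpace ℂ H] [CompleteSpace H]

lemma ext' {ρ ρ' : CovRep S H} (h : ∀ a, ρ.π a = ρ'.π a) (hU : ρ.U = ρ'.U) : ρ = ρ' := by
  have h' : ρ.π = ρ'.π := DFunLike.ext _ _ h
  cases ρ
  cases ρ'
  cases h'
  cases hU
  rfl

lemma image_initial (π : A →⋆ₙₐ[ℂ] (H →L[ℂ] H)) :
    {v | ∃ a ∈ S.vanishingOutside (Set.range (CommEndo.dual S.δ)), ∃ w, π a w = v} =
      Set.range (π S.rangeProj) := by
  ext v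
  constructor
  · rintro ⟨a, ha, w, rfl⟩
    refine ⟨π a w, ?_⟩
    rw [← mul_apply_eq_comp, ← map_mul, S.mem_vanishingOutside_range.1 ha]
  · rintro ⟨w, rfl⟩
    exact ⟨_, S.mem_vanishingOutside_range.2 S.rangeProj_mul_self, w, rfl⟩

lemma image_final (π : A →⋆ₙₐ[ℂ] (H →L[ℂ] H)) :
    {v | ∃ a ∈ S.vanishingOutside (CommEndo.dom S.δ), ∃ w, π a w = v} =
      Set.range (π (S.δ 1)) := by
  ext v
  constructor
  · rintro ⟨a, ha, w, rfl⟩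
    refine ⟨π a w, ?_⟩
    rw [← mul_apply_eq_comp, ← map_mul, S.mem_vanishingOutside_dom.1 ha]
  · rintro ⟨w, rfl⟩
    refine ⟨_, S.mem_vanishingOutside_dom.2 ?_, w, rfl⟩
    rw [← map_mul, mul_one]

/-- The covariant representation given by a partial isometry with prescribed initial and final
projections. -/
def ofProjections (π : A →⋆ₙₐ[ℂ] (H →L[ℂ] H)) (U : H →L[ℂ] H) (hU : U * star U * U = U)
    (hi : star U * U = π S.rangeProj) (hf : U * star U = π (S.δ 1))
    (hc : ∀ a, U * π a * star U = π (S.δ a)) : CovRep S H where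
  π := π
  U := U
  isPartialIsometry := hU
  initial := by rw [image_initial, ← hi, range_star_mul_self hU]
  final := by rw [image_final, ← hf, range_mul_star_self hU]
  covariant := hc

variable (ρ : CovRep S H)

lemma star_isPartialIsometry : star ρ.U * ρ.U * star ρ.U = star ρ.U := by
  have h1 := congrArg star ρ.isPartialIsometry
  rwa [star_mul, star_mul, star_star, ← mul_assoc] at h1

/-- This and `U_mul_star_U` turn the geometric conditions on the initial and final space into
operator identities; the later computations rest on these. -/
lemma star_U_mul_U : star ρ.U * ρ.U = ρ.π S.rangeProj := by
  refine eq_of_range_eq_of_projection ?_ ?_ ?_ ?_ ?_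
  · rw [star_mul, star_star]
  · rw [← mul_assoc, ρ.star_isPartialIsometry]
  · rw [← map_star, S.star_rangeProj]
  · rw [← map_mul, S.rangeProj_mul_self]
  · rw [range_star_mul_self ρ.isPartialIsometry, ρ.initial, image_initial]

lemma U_mul_star_U : ρ.U * star ρ.U = ρ.π (S.δ 1) := by
  refine eq_of_range_eq_of_projection ?_ ?_ ?_ ?_ ?_
  · rw [star_mul, star_star]
  · rw [← mul_assoc, ρ.isPartialIsometry]
  · rw [← map_star, ← map_star, star_one]
  · rw [← map_mul, ← map_mul, mul_one]
  · rw [range_mul_star_self ρ.isPartialIsometry, ρ.final, image_final]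

lemma U_mul_map_rangeProj : ρ.U * ρ.π S.rangeProj = ρ.U := by
  rw [← ρ.star_U_mul_U, ← mul_assoc, ρ.isPartialIsometry]

lemma U_mul_map_one : ρ.U * ρ.π 1 = ρ.U := by
  rw [← ρ.U_mul_map_rangeProj, mul_assoc, ← map_mul, mul_one]

/-- Multiply covariance by `U` on the right: `U*U = π(p)` commutes with `π(a)` and is absorbed by
`U`. -/
lemma U_mul_map (a : A) : ρ.U * ρ.π a = ρ.π (S.δ a) * ρ.U := by
  rw [← ρ.covariant, mul_assoc, ρ.star_U_mul_U, mul_assoc, ← map_mul, mul_comm a, map_mul,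
    ← mul_assoc, ρ.U_mul_map_rangeProj]

lemma U_pow_mul_map (n : ℕ) (a : A) : ρ.U ^ n * ρ.π a = ρ.π ((S.δ ^ n) a) * ρ.U ^ n := by
  induction n with
  | zero => rw [pow_zero, one_mul, mul_one]; rfl
  | succ n ih =>
    rw [pow_succ', mul_assoc, ih, ← mul_assoc, ρ.U_mul_map, mul_assoc, pow_succ' S.δ]
    rfl

lemma map_mul_star_U_pow (n : ℕ) (a : A) :
    ρ.π a * star ρ.U ^ n = star ρ.U ^ n * ρ.π ((S.δ ^ n) a) := by
  have h := congrArg star (ρ.U_pow_mul_map n (star a))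
  rwa [star_mul, star_mul, star_pow, ← map_star, ← map_star, ← map_star, star_star] at h

/-- The factor `π(a)` keeps the case `n = 0` valid when `π(1)` is not the identity. -/
lemma map_mul_U_pow_mul_star (n : ℕ) (a : A) :
    ρ.π a * ρ.U ^ n * star ρ.U ^ n = ρ.π (a * (S.δ ^ n) 1) := by
  induction n generalizing a with
  | zero =>
    change ρ.π a * 1 * 1 = ρ.π (a * 1)
    rw [mul_one, mul_one, mul_one]
  | succ n ih =>
    -- Covariance at `δ^n(1)`, combined with the induction hypothesis for `a = 1`, yields `U^(n+1)
    -- U*^(n+1) = π(δ^(n+1)(1))`.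
    have h := ρ.covariant ((S.δ ^ n) 1)
    rw [← one_mul ((S.δ ^ n) 1), ← ih, ← mul_assoc, ← mul_assoc, ρ.U_mul_map_one, one_mul] at h
    rw [map_mul, pow_succ' S.δ, pow_succ', pow_succ]
    change _ = _ * ρ.π (S.δ ((S.δ ^ n) 1))
    rw [← h]
    simp only [mul_assoc]

lemma map_mul_U_pow (n : ℕ) (a : A) : ρ.π (a * (S.δ ^ n) 1) * ρ.U ^ n = ρ.π a * ρ.U ^ n := by
  induction n generalizing a with
  | zero =>
    change ρ.π (a * 1) * _ = _
    rw [mul_one]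
  | succ n ih =>
    have h : ρ.U * (ρ.π (1 * (S.δ ^ n) 1) * ρ.U ^ n) = ρ.U * (ρ.π 1 * ρ.U ^ n) := by rw [ih]
    rw [← mul_assoc, ← mul_assoc, ρ.U_mul_map_one, ρ.U_mul_map, one_mul] at h
    rw [map_mul, mul_assoc, pow_succ' ρ.U, pow_succ' S.δ, ← mul_assoc (ρ.π ((S.δ * S.δ ^ n) 1))]
    exact congrArg _ h

/-- The representation `a ↦ U*^k π(a) U^k` of `A`. -/
def compression (k : ℕ) : A →⋆ₙₐ[ℂ] (H →L[ℂ] H) where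
  toFun a := star ρ.U ^ k * ρ.π a * ρ.U ^ k
  map_smul' c a := by
    rw [map_smul, mul_smul_comm, smul_mul_assoc]
    rfl
  map_zero' := by rw [map_zero, mul_zero, zero_mul]
  map_add' a b := by rw [map_add, mul_add, add_mul]
  map_mul' a b := by
    -- Between `π(a)` and `π(b)` one may insert `U^k U*^k`: it acts as `π(δ^k(1))`, which `U^k`
    -- absorbs on the right.
    have h := ρ.map_mul_U_pow_mul_star k a
    calc star ρ.U ^ k * ρ.π (a * b) * ρ.U ^ k
        = star ρ.U ^ k * (ρ.π (a * b * (S.δ ^ k) 1) * ρ.U ^ k) := by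
          rw [ρ.map_mul_U_pow, mul_assoc]
      _ = star ρ.U ^ k * (ρ.π a * ρ.U ^ k * star ρ.U ^ k) * ρ.π b * ρ.U ^ k := by
          rw [h, mul_right_comm a b, map_mul ρ.π (a * _) b]
          simp only [mul_assoc]
      _ = _ := by simp only [mul_assoc]
  map_star' a := by
    rw [star_mul, star_mul, star_pow, star_pow, star_star, map_star, mul_assoc]

lemma compression_apply (k : ℕ) (a : A) :
    ρ.compression k a = star ρ.U ^ k * ρ.π a * ρ.U ^ k := rfl

lemma compression_zero (a : A) : ρ.compression 0 a = ρ.π a := by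
  rw [compression_apply, pow_zero, pow_zero, one_mul, mul_one]

lemma compression_succ (k : ℕ) (a : A) :
    ρ.compression (k + 1) a = star ρ.U * ρ.compression k a * ρ.U := by
  rw [compression_apply, compression_apply, pow_succ', pow_succ]
  simp only [mul_assoc]

/-- First relation for `exists_coeffHom`. The case `k = 0` is `U* π(δ(a)) U = U*U π(a) = π(p a)`;
the general case is this identity between powers of `U*` and `U`. -/
lemma compression_rangeProj_mul (k : ℕ) (a : A) :
    ρ.compression k (S.rangeProj * a) = ρ.compression (k + 1) (S.δ a) := by
  have h : star ρ.U * ρ.π (S.δ a) * ρ.U = ρ.π (S.rangeProj * a) := by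
    rw [mul_assoc, ← ρ.U_mul_map, ← mul_assoc, ρ.star_U_mul_U, map_mul]
  rw [compression_apply, ← h, compression_apply, pow_succ, pow_succ']
  simp only [mul_assoc]

/-- Second relation: `π(δ(1)) = UU*` is absorbed by the adjacent `U`. -/
lemma compression_δ_one_mul (k : ℕ) (a : A) :
    ρ.compression (k + 1) (S.δ 1 * a) = ρ.compression (k + 1) a := by
  rw [compression_apply, compression_apply, mul_comm, map_mul, ← ρ.U_mul_star_U, pow_succ' ρ.U]
  have h := ρ.isPartialIsometry
  calc _ = star ρ.U ^ (k + 1) * ρ.π a * (ρ.U * star ρ.U * ρ.U * ρ.U ^ k) := by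
        simp only [mul_assoc]
    _ = _ := by rw [h]

lemma map_mul_compression (m : ℕ) (a b : A) :
    ρ.π a * ρ.compression m b = ρ.compression m ((S.δ ^ m) a * b) := by
  rw [compression_apply, compression_apply, map_mul, ← mul_assoc, ← mul_assoc,
    ρ.map_mul_star_U_pow]
  simp only [mul_assoc]

/-- The inner `U^k U*^k` becomes `π(δ^k(1))`, and the resulting element of `π(A)` moves past `U*^m`
by applying `δ^m`. -/
lemma compression_mul_compression (k m : ℕ) (a b : A) :
    ρ.compression k a * ρ.compression (k + m) b =
      ρ.compression (k + m) ((S.δ ^ m) (a * (S.δ ^ k) 1) * b) := by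
  have h : ∀ b, ρ.compression (k + m) b = star ρ.U ^ k * ρ.compression m b * ρ.U ^ k := fun b => by
    rw [compression_apply, compression_apply, pow_add, add_comm, pow_add ρ.U]
    simp only [mul_assoc]
  rw [h, h, ← ρ.map_mul_compression, ← ρ.map_mul_U_pow_mul_star, compression_apply]
  simp only [mul_assoc]

/-- The product formula collects `a` and `b` inside the commutative algebra `A`. Its adjoint, taken
at `a*` and `b*`, reverses the left side but reproduces the same right side. -/
lemma commute_compression (k l : ℕ) (a b : A) :
    ρ.compression k a * ρ.compression l b = ρ.compression l b * ρ.compression k a := by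
  have key : ∀ k m a b, ρ.compression k a * ρ.compression (k + m) b =
      ρ.compression (k + m) b * ρ.compression k a := fun k m a b => by
    have h := congrArg star (ρ.compression_mul_compression k m (star a) (star b))
    have h' : star ((S.δ ^ m) (star a * (S.δ ^ k) 1) * star b) =
        (S.δ ^ m) (a * (S.δ ^ k) 1) * b := by
      rw [star_mul, star_star, ← map_star, star_mul, star_star, ← map_star, star_one,
        mul_comm b, mul_comm a]
    rw [star_mul, ← map_star, ← map_star, ← map_star, star_star, star_star, h'] at h
    rw [h, compression_mul_compression]
  rcases le_total k l with h | h
  · obtain ⟨m, rfl⟩ := Nat.exists_eq_add_of_le h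
    exact key k m a b
  · obtain ⟨m, rfl⟩ := Nat.exists_eq_add_of_le h
    exact (key l m b a).symm

/-- The bicommutant of a set of operators. -/
def bicommutant (s : Set (H →L[ℂ] H)) : StarSubalgebra ℂ (H →L[ℂ] H) :=
  StarSubalgebra.centralizer ℂ (StarSubalgebra.centralizer ℂ s : Set (H →L[ℂ] H))

instance (s : Set (H →L[ℂ] H)) : IsClosed (bicommutant s : Set (H →L[ℂ] H)) :=
  Set.isClosed_centralizer _

lemma subset_bicommutant (s : Set (H →L[ℂ] H)) : s ⊆ bicommutant s :=
  (StarAlgebra.subset_adjoin ℂ s).trans (StarAlgebra.adjoin_le_centralizer_centralizer ℂ s)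

lemma bicommutant_comm {s : Set (H →L[ℂ] H)} (h1 : ∀ x ∈ s, star x ∈ s)
    (h2 : ∀ x ∈ s, ∀ y ∈ s, x * y = y * x) (x y : bicommutant s) : x * y = y * x := by
  have hs : s ∪ star s = s := Set.union_eq_self_of_subset_right fun x hx => by
    simpa using h1 _ hx
  have hx := x.2
  have hy := y.2
  have hb : (bicommutant s : Set (H →L[ℂ] H)) = s.centralizer.centralizer := by
    refine (StarSubalgebra.coe_centralizer_centralizer ℂ s).trans ?_
    rw [hs]
  rw [← SetLike.mem_coe, hb] at hx hy
  exact Subtype.ext (Set.centralizer_centralizer_comm_of_comm h2 _ hx _ hy)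

/-- The universal property needs a commutative C*-algebra as target; the bicommutant of the
commuting, self-adjoint family of compressions is one. -/
lemma exists_coeffRep : ∃ φ : S.Coeff →⋆ₙₐ[ℂ] (H →L[ℂ] H),
    ∀ k a, φ (S.coord k a) = ρ.compression k a := by
  let s : Set (H →L[ℂ] H) := {x | ∃ k a, ρ.compression k a = x}
  have hc : ∀ x y : bicommutant s, x * y = y * x := by
    refine bicommutant_comm ?_ ?_
    · rintro _ ⟨k, a, rfl⟩
      exact ⟨k, star a, map_star _ _⟩
    · rintro _ ⟨k, a, rfl⟩ _ ⟨l, b, rfl⟩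
      exact ρ.commute_compression k l a b
  let _ : CommCStarAlgebra (bicommutant s) :=
    { (inferInstance : CStarAlgebra (bicommutant s)) with mul_comm := hc }
  let t (k : ℕ) : A →⋆ₙₐ[ℂ] bicommutant s :=
    { toFun := fun a => ⟨ρ.compression k a, subset_bicommutant s ⟨k, a, rfl⟩⟩
      map_smul' := fun c a => Subtype.ext (map_smul (ρ.compression k) c a)
      map_zero' := Subtype.ext (map_zero (ρ.compression k))
      map_add' := fun a b => Subtype.ext (map_add (ρ.compression k) a b)
      map_mul' := fun a b => Subtype.ext (map_mul (ρ.compression k) a b)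
      map_star' := fun a => Subtype.ext (map_star (ρ.compression k) a) }
  obtain ⟨φ, hφ⟩ := exists_coeffHom (S := S) (t := t)
    (fun k a => Subtype.ext (ρ.compression_rangeProj_mul k a))
    (fun k a => Subtype.ext (ρ.compression_δ_one_mul k a))
  refine ⟨((bicommutant s).subtype : _ →⋆ₙₐ[ℂ] (H →L[ℂ] H)).comp φ, fun k a => ?_⟩
  exact congrArg Subtype.val (hφ k a)

/-- Conjugation by `U*`, as a representation. -/
def conjHom (φ : S.Coeff →⋆ₙₐ[ℂ] (H →L[ℂ] H))
    (hφ : ∀ k a, φ (S.coord k a) = ρ.compression k a) : S.Coeff →⋆ₙₐ[ℂ] (H →L[ℂ] H) where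
  toFun f := star ρ.U * φ f * ρ.U
  map_smul' c f := by
    rw [map_smul, mul_smul_comm, smul_mul_assoc]
    rfl
  map_zero' := by rw [map_zero, mul_zero, zero_mul]
  map_add' f g := by rw [map_add, mul_add, add_mul]
  map_mul' f g := by
    have h : ρ.U * star ρ.U = φ (S.coord 0 (S.δ 1)) := by
      rw [hφ, compression_zero, U_mul_star_U]
    -- `UU*` lies in the image of the commutative algebra `C(X̃)`, so it can be moved between `φ(f)`
    -- and `φ(g)`.
    calc star ρ.U * φ (f * g) * ρ.U
        = star ρ.U * φ (f * g) * (ρ.U * star ρ.U * ρ.U) := by rw [ρ.isPartialIsometry]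
      _ = star ρ.U * φ f * (φ g * (ρ.U * star ρ.U)) * ρ.U := by
          rw [map_mul]
          simp only [mul_assoc]
      _ = star ρ.U * φ f * ((ρ.U * star ρ.U) * φ g) * ρ.U := by
          rw [h, ← map_mul, ← map_mul, mul_comm g]
      _ = _ := by simp only [mul_assoc]
  map_star' f := by
    rw [star_mul, star_mul, star_star, map_star, mul_assoc]

/-- Both sides of `conj_inv` are `*`-homomorphisms of `C(X̃)`. On `coord k a` each equals the
compression of order `k + 1`. -/
lemma isCovariantPair {φ : S.Coeff →⋆ₙₐ[ℂ] (H →L[ℂ] H)}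
    (hφ : ∀ k a, φ (S.coord k a) = ρ.compression k a) : S.extAut.IsCovariantPair φ ρ.U where
  isPartialIsometry := ρ.isPartialIsometry
  mul_star := by rw [extAut_hom_one, hφ, compression_zero, U_mul_star_U]
  star_mul := by rw [extAut_inv_one, hφ, compression_zero, star_U_mul_U]
  conj_inv f := by
    have h : ρ.conjHom φ hφ = φ.comp S.extAut.inv := coeffHom_ext S fun k a => by
      change star ρ.U * φ (S.coord k a) * ρ.U = φ (S.extAut.inv (S.coord k a))
      rw [extAut_inv_coord, hφ, hφ, compression_succ]
    exact DFunLike.congr_fun h f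

/-- The covariant representation `(σ|_A, σ(u))` defined by a representation `σ` of the covariance
algebra. -/
def ofRep (σ : S.CovarianceAlgebra →⋆ₙₐ[ℂ] (H →L[ℂ] H)) : CovRep S H :=
  ofProjections ((σ.comp S.extAut.ofCoeff).comp (S.coordHom 0)) (σ S.extAut.u)
    (by rw [← map_star, ← map_mul, ← map_mul, PartialAut.u_mul_star_u_mul_u])
    (by
      rw [← map_star, ← map_mul, PartialAut.star_u_mul_u, extAut_inv_one]
      rfl)
    (by
      rw [← map_star, ← map_mul, PartialAut.u_mul_star_u, extAut_hom_one]
      rfl)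
    (fun a => by
      change _ * σ (S.extAut.ofCoeff (S.coord 0 a)) * _ = σ (S.extAut.ofCoeff (S.coord 0 (S.δ a)))
      rw [← map_star, ← map_mul, ← map_mul, PartialAut.u_mul_ofCoeff_mul_star_u,
        extAut_hom_coord_zero])

lemma incl_eq (a : A) : S.incl a = S.extAut.ofCoeff (S.coord 0 a) :=
  S.extAut.mono_congr rfl (S.bracket_single 0 a)

lemma ofRep_π (σ : S.CovarianceAlgebra →⋆ₙₐ[ℂ] (H →L[ℂ] H)) (a : A) :
    (ofRep σ).π a = σ (S.incl a) := by
  rw [incl_eq]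
  rfl

lemma ofRep_U (σ : S.CovarianceAlgebra →⋆ₙₐ[ℂ] (H →L[ℂ] H)) : (ofRep σ).U = σ S.extAut.u := rfl

/-- A representation of the covariance algebra is determined by its restriction to `A` and its
value at `u`. -/
lemma rep_ext {σ σ' : S.CovarianceAlgebra →⋆ₙₐ[ℂ] (H →L[ℂ] H)}
    (h : ∀ a, σ (S.incl a) = σ' (S.incl a)) (hu : σ S.extAut.u = σ' S.extAut.u) : σ = σ' := by
  have hφ : σ.comp S.extAut.ofCoeff = σ'.comp S.extAut.ofCoeff := coeffHom_ext S fun k a => by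
    change σ (S.extAut.ofCoeff (S.coord k a)) = σ' (S.extAut.ofCoeff (S.coord k a))
    induction k with
    | zero => rw [← incl_eq, h]
    | succ k ih =>
      -- Each further copy of `A` is obtained from the previous one by conjugating with `u*`.
      rw [← extAut_inv_coord, ← PartialAut.star_u_mul_ofCoeff_mul_u, map_mul, map_mul, map_mul,
        map_mul, map_star, map_star, ih, hu]
  exact PartialAut.hom_ext_of_u (fun c => DFunLike.congr_fun hφ c) hu

/-! ### Uniqueness and range of the integrated form -/

section IntegratedForm

variable {ρ} {Ψ : S.CovarianceAlgebra →⋆ₙₐ[ℂ] (H →L[ℂ] H)}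

/-- The defining formula is used for the family concentrated at `n`, with `N = |n|`; all other terms
vanish on both sides. -/
lemma IsIntegratedForm.map_mono (h : ρ.IsIntegratedForm Ψ) (n : ℤ) {c : ℕ →₀ A}
    (hc : c ∈ S.seqs) (hD : S.bracket c ∈ S.extAut.D n) :
    Ψ (S.extAut.mono n ⟨S.bracket c, hD⟩) =
      (c.sum fun k d => star ρ.U ^ k * ρ.π d * ρ.U ^ k) * partialIsometryPow ρ.U n := by
  have hb : S.bracket (0 : ℕ →₀ A) = 0 := Finsupp.sum_zero_index
  have hn : n ∈ Finset.Icc (-(n.natAbs : ℤ)) n.natAbs := by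
    rw [Finset.mem_Icc]
    omega
  have h0 : ∀ m, m ≠ n → (Pi.single n c : ℤ → ℕ →₀ A) m = 0 := fun m hm => Pi.single_eq_of_ne hm _
  have hn' : (Pi.single n c : ℤ → ℕ →₀ A) n = c := Pi.single_eq_same _ _
  have h1 := h n.natAbs (Pi.single n c) (fun m => by
    by_cases hm : m = n
    · subst hm
      rwa [hn']
    · rw [h0 m hm]
      exact fun _ => ⟨0, by simp⟩) (fun m => by
    by_cases hm : m = n
    · subst hm
      rwa [hn']
    · rw [h0 m hm, hb]
      exact zero_mem _)
  rw [Finset.sum_eq_single_of_mem n hn fun m _ hm => (S.extAut.mono_congr rfl (by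
      change S.bracket ((Pi.single n c : ℤ → ℕ →₀ A) m) = 0
      rw [h0 m hm, hb])).trans (S.extAut.mono_zero m (zero_mem _)),
    Finset.sum_eq_single_of_mem n hn fun m _ hm => by
      rw [h0 m hm, Finsupp.sum_zero_index, zero_mul]] at h1
  refine (congrArg Ψ (S.extAut.mono_congr rfl (congrArg S.bracket hn'.symm))).trans (h1.trans ?_)
  rw [hn']

lemma IsIntegratedForm.map_incl (h : ρ.IsIntegratedForm Ψ) (a : A) : Ψ (S.incl a) = ρ.π a := by
  refine (h.map_mono 0 (c := Finsupp.single 0 a) (fun k => ?_) _).trans ?_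
  · cases k with
    | zero => exact ⟨a, by rw [Finsupp.single_eq_same]; exact (one_mul a).symm⟩
    | succ k => exact ⟨0, by simp⟩
  · rw [Finsupp.sum_single_index (by simp)]
    change _ * 1 = _
    rw [mul_one, pow_zero, pow_zero, one_mul, mul_one]

/-- As a monomial `u` is `[δ(1), 0, …] u^1`, so its image is `π(δ(1)) U = UU*U = U`. -/
lemma IsIntegratedForm.map_u (h : ρ.IsIntegratedForm Ψ) : Ψ S.extAut.u = ρ.U := by
  have hb : S.bracket (Finsupp.single 0 (S.δ 1)) = S.extAut.pow 1 1 := by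
    rw [S.bracket_single, ← S.extAut_hom_one]
    rfl
  have h1 := h.map_mono 1 (c := Finsupp.single 0 (S.δ 1)) (fun k => by
    cases k with
    | zero => exact ⟨S.δ 1, by rw [Finsupp.single_eq_same]; exact (one_mul _).symm⟩
    | succ k => exact ⟨0, by simp⟩) (by
      rw [hb]
      exact S.extAut.pow_mem_D 1 1)
  rw [Finsupp.sum_single_index (by simp), pow_zero, pow_zero, one_mul, mul_one,
    ← ρ.U_mul_star_U] at h1
  have h2 : partialIsometryPow ρ.U 1 = ρ.U := pow_one _
  rw [h2, ρ.isPartialIsometry] at h1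
  rw [← h1]
  exact congrArg Ψ (S.extAut.mono_congr rfl hb.symm)

lemma IsIntegratedForm.unique {Ψ' : S.CovarianceAlgebra →⋆ₙₐ[ℂ] (H →L[ℂ] H)}
    (h : ρ.IsIntegratedForm Ψ) (h' : ρ.IsIntegratedForm Ψ') : Ψ' = Ψ :=
  rep_ext (fun a => (h'.map_incl a).trans (h.map_incl a).symm) (h'.map_u.trans h.map_u.symm)

variable (ρ)

lemma map_mem_generated (a : A) : ρ.π a ∈ ρ.generated :=
  NonUnitalStarSubalgebra.le_topologicalClosure _
    (NonUnitalStarAlgebra.subset_adjoin ℂ _ (Or.inl ⟨a, rfl⟩))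

lemma U_mem_generated : ρ.U ∈ ρ.generated :=
  NonUnitalStarSubalgebra.le_topologicalClosure _
    (NonUnitalStarAlgebra.subset_adjoin ℂ _ (Or.inr rfl))

lemma isClosed_generated : IsClosed (ρ.generated : Set (H →L[ℂ] H)) :=
  NonUnitalStarSubalgebra.isClosed_topologicalClosure _

lemma compression_mem_generated (k : ℕ) (a : A) : ρ.compression k a ∈ ρ.generated := by
  induction k with
  | zero =>
    rw [compression_zero]
    exact ρ.map_mem_generated a
  | succ k ih =>
    rw [compression_succ]
    exact mul_mem (mul_mem (star_mem ρ.U_mem_generated) ih) ρ.U_mem_generated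

lemma mul_pow_mem_generated {x : H →L[ℂ] H} (hx : x ∈ ρ.generated) (n : ℤ) :
    x * partialIsometryPow ρ.U n ∈ ρ.generated := by
  have key : ∀ V ∈ ρ.generated, ∀ n : ℕ, x * V ^ n ∈ ρ.generated := fun V hV n => by
    induction n with
    | zero => rwa [pow_zero, mul_one]
    | succ n ih =>
      rw [pow_succ, ← mul_assoc]
      exact mul_mem ih hV
  obtain ⟨n, rfl | rfl⟩ := n.eq_nat_or_neg
  · exact key _ ρ.U_mem_generated n
  · rw [partialIsometryPow_neg_natCast]
    exact key _ (star_mem ρ.U_mem_generated) n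

/-- The range lies in `C*(π(A), U)` because monomials and, in turn, the generators `coord k a` are
sent there. The converse holds because the range is closed and contains `π(A)` and `U`. -/
lemma exists_isIntegratedForm : ∃ Ψ : S.CovarianceAlgebra →⋆ₙₐ[ℂ] (H →L[ℂ] H),
    ρ.IsIntegratedForm Ψ ∧ NonUnitalStarAlgHom.range Ψ = ρ.generated := by
  obtain ⟨φ, hφ⟩ := ρ.exists_coeffRep
  obtain ⟨Ψ, hΨ⟩ := (ρ.isCovariantPair hφ).exists_integratedForm
  have hint : ρ.IsIntegratedForm Ψ := fun N a _ hD => by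
    rw [map_sum]
    refine Finset.sum_congr rfl fun n _ => ?_
    rw [hΨ]
    congr 1
    change φ (∑ k ∈ (a n).support, S.coord k (a n k)) = ∑ k ∈ (a n).support, _
    rw [map_sum]
    exact Finset.sum_congr rfl fun k _ => hφ k _
  refine ⟨Ψ, hint, le_antisymm ?_ ?_⟩
  · rintro _ ⟨x, rfl⟩
    refine PartialAut.hom_mem_of_forall_mono (M := ρ.generated.toSubmodule) ρ.isClosed_generated
      (fun n c => ?_) x
    rw [hΨ]
    exact ρ.mul_pow_mem_generated (S.map_mem_of_forall_coord ρ.isClosed_generated (fun k a => by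
      rw [hφ]
      exact ρ.compression_mem_generated k a) _) n
  · refine NonUnitalStarSubalgebra.topologicalClosure_minimal _
      (NonUnitalStarAlgebra.adjoin_le ?_) Ψ.isClosed_range
    rintro _ (⟨a, rfl⟩ | rfl)
    · exact ⟨S.incl a, hint.map_incl a⟩
    · exact ⟨S.extAut.u, hint.map_u⟩

/-- The representation of the covariance algebra defined by a covariant representation. -/
def toRep : S.CovarianceAlgebra →⋆ₙₐ[ℂ] (H →L[ℂ] H) := ρ.exists_isIntegratedForm.choose

lemma isIntegratedForm_toRep : ρ.IsIntegratedForm ρ.toRep :=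
  ρ.exists_isIntegratedForm.choose_spec.1

lemma range_toRep : NonUnitalStarAlgHom.range ρ.toRep = ρ.generated :=
  ρ.exists_isIntegratedForm.choose_spec.2

/-- The correspondence between covariant representations of `(A, δ)` and representations of the
covariance algebra. -/
def equivRep : CovRep S H ≃ (S.CovarianceAlgebra →⋆ₙₐ[ℂ] (H →L[ℂ] H)) where
  toFun := toRep
  invFun := ofRep
  left_inv ρ := ext' (fun a => by rw [ofRep_π, ρ.isIntegratedForm_toRep.map_incl])
    (by rw [ofRep_U, ρ.isIntegratedForm_toRep.map_u])
  right_inv σ := rep_ext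
    (fun a => by rw [(isIntegratedForm_toRep _).map_incl, ofRep_π])
    (by rw [(isIntegratedForm_toRep _).map_u, ofRep_U])

end IntegratedForm

end CovRep

end

theorem mainTheorem3 {A : Type*} [CommCStarAlgebra A] (S : CommDynSystem A)
    {H : Type*} [NormedAddCommGroup H] [InnerProductSpace ℂ H] [CompleteSpace H] :
    (∀ ρ : CovRep S H, (Function.Injective ρ.π ∨ Function.Injective S.δ) →
      ∃ Ψ : S.CovarianceAlgebra →⋆ₙₐ[ℂ] (H →L[ℂ] H),
        ρ.IsIntegratedForm Ψ ∧ NonUnitalStarAlgHom.range Ψ = ρ.generated ∧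
        ∀ Ψ' : S.CovarianceAlgebra →⋆ₙₐ[ℂ] (H →L[ℂ] H), ρ.IsIntegratedForm Ψ' → Ψ' = Ψ) ∧
    (∀ σ : S.CovarianceAlgebra →⋆ₙₐ[ℂ] (H →L[ℂ] H),
      ∃ ρ : CovRep S H, (∀ a, ρ.π a = σ (S.incl a)) ∧ ρ.U = σ S.extAut.u) ∧
    (Function.Injective S.δ →
      ∃ e : CovRep S H ≃ (S.CovarianceAlgebra →⋆ₙₐ[ℂ] (H →L[ℂ] H)),
        (∀ ρ : CovRep S H, ρ.IsIntegratedForm (e ρ)) ∧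
        ∀ σ : S.CovarianceAlgebra →⋆ₙₐ[ℂ] (H →L[ℂ] H),
          (∀ a, (e.symm σ).π a = σ (S.incl a)) ∧ (e.symm σ).U = σ S.extAut.u) :=
  ⟨fun ρ _ => ⟨ρ.toRep, ρ.isIntegratedForm_toRep, ρ.range_toRep,
      fun _ h => ρ.isIntegratedForm_toRep.unique h⟩,
    fun σ => ⟨CovRep.ofRep σ, CovRep.ofRep_π σ, CovRep.ofRep_U σ⟩,
    fun _ => ⟨CovRep.equivRep, CovRep.isIntegratedForm_toRep,
      fun σ => ⟨CovRep.ofRep_π σ, CovRep.ofRep_U σ⟩⟩⟩
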